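/- Let $D\ge 1$ and $\ell\ge 2$ be integers. For $n\ge 0$ let $\mathcal F_n$ be the family of $\ell$-adic cubes $\prod_{i=1}^D[k_i\ell^{-n},(k_i+1)\ell^{-n})$, $0\le k_i<\ell^n$, of $[0,1)^D$. Suppose that for every $n$ the cubes in $\mathcal F_n$ are coded bijectively by the words $\varepsilon_1\cdots\varepsilon_n$ over $\{0,\dots,\ell^D-1\}$, in such a way that $I_{\varepsilon_1\cdots\varepsilon_{n+1}}\subset I_{\varepsilon_1\cdots\varepsilon_n}$ always; if $I$ and $J$ are coded by the words $w$ and $v$, let $IJ$ be the cube coded by the concatenation $wv$. Let $m$ be a Borel probability measure on $\mathbb R^D$ with $m([0,1)^D)=1$ which is quasi-Bernoulli: there is a constant $C\ge 1$ with $$\frac1C\,m(I)m(J)\le m(IJ)\le C\,m(I)m(J)\qquad\text{for all } I,J\in\bigcup_n\mathcal F_n .$$ Let $$\tau(q)=\limsup_{n\to\infty}\frac1{n\log\ell}\log\Bigl(\sum_{I\in\mathcal F_n,\ m(I)>0}m(I)^q\Bigr)$$ be its $L^q$-spectrum and $d=-\tau'(1)$. Suppose that there is a real $\sigma\ge 0$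 such that $\tau(1-q)=qd+\frac{\sigma^2}2q^2+o(q^2)$ as $q\to 0$. For small $t>0$ put $$\Theta(t)=\ell^{\sqrt{2\,\log_\ell(1/t)\;\log_\ell\log_\ell\log_\ell(1/t)}} .$$ For a gauge $\Psi$, let $\mathcal H^\Psi$ be the Hausdorff measure on $\mathbb R^D$, $\mathcal H^\Psi(E)=\lim_{\delta\to0}\inf\{\sum_i\Psi(\operatorname{diam}U_i)\}$, the infimum being over countable coverings of $E$ by sets $U_i$ of diameter at most $\delta$ (with $\Psi(0)=\lim_{t\to 0^+}\Psi(t)\in[0,\infty]$, and the empty set contributing $0$); let $\mathcal P^\Psi(E)=\lim_{\delta\to0}\sup\{\sum_i\Psi(2r_i)\}$, the supremum being over families of pairwise disjoint closed balls $B(x_i,r_i)$ with $x_i\in E$ and $0<r_i\le\delta$; and let $\widehat{\mathcal P}^\Psi(E)=\inf\{\sum_i\mathcal P^\Psi(E_i):E\subset\bigcup_{i\in\mathbb N}E_i\}$ be the packing measure. Then, for every $\varepsilon>0$, 1. $m\ll\mathcal H^\Psi$, where $\Psi(t)=t^d\,\Theta(t)^{\sigma+\varepsilon}$; 2. $m\perp\widehat{\mathcal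 P}^\Psi$, where $\Psi(t)=t^d\,\Theta(t)^{-(\sigma+\varepsilon)}$. -/

import Mathlib

open MeasureTheory Filter Topology Asymptotics
open scoped ENNReal

noncomputable section

/-! ### Hausdorff measures with a general gauge -/

/-- The value that a gauge `Ψ`, given on `(0, ∞)`, assigns to a diameter. At a diameter `0`
the gauge is extended by its limit at `0` from the right. -/
def gaugeValue (Ψ : ℝ → ℝ) (r : ℝ≥0∞) : ℝ≥0∞ :=
  if r = 0 then limsup (fun t : ℝ => ENNReal.ofReal (Ψ t)) (𝓝[>] 0)
  else ENNReal.ofReal (Ψ r.toReal)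

/-- The Hausdorff measure `ℋ^Ψ` with gauge `Ψ`: the limit as `δ → 0` of the infimum of
`∑ Ψ (diam U_i)` over countable coverings by sets `U_i` of diameter at most `δ`. -/
def hausdorffGaugeMeasure {X : Type*} [EMetricSpace X] [MeasurableSpace X] [BorelSpace X]
    (Ψ : ℝ → ℝ) : Measure X :=
  Measure.mkMetric (gaugeValue Ψ)

/-! ### Packing measures with a general gauge -/

/-- `P` is a `δ`-packing of `E`: a family of pairwise disjoint closed balls `B(x, r)`,
recorded as pairs `(x, r)`, with centres `x ∈ E` and radii `0 < r ≤ δ`. -/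
structure IsPacking {X : Type*} [MetricSpace X] (δ : ℝ) (E : Set X) (P : Set (X × ℝ)) :
    Prop where
  center_mem : ∀ p ∈ P, p.1 ∈ E
  radius_pos : ∀ p ∈ P, 0 < p.2
  radius_le : ∀ p ∈ P, p.2 ≤ δ
  disjoint : P.PairwiseDisjoint fun p => Metric.closedBall p.1 p.2

/-- The supremum of `∑ Ψ (2 r_i)` over all `δ`-packings `(B(x_i, r_i))` of `E`. -/
def packingSup {X : Type*} [MetricSpace X] (Ψ : ℝ → ℝ) (δ : ℝ) (E : Set X) : ℝ≥0∞ :=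
  ⨆ (P : Set (X × ℝ)) (_ : IsPacking δ E P), ∑' p : P, ENNReal.ofReal (Ψ (2 * p.1.2))

/-- The packing pre-measure `𝒫^Ψ (E)`: the (decreasing) limit of `packingSup Ψ δ E`
as `δ → 0`. -/
def packingPremeasure {X : Type*} [MetricSpace X] (Ψ : ℝ → ℝ) (E : Set X) : ℝ≥0∞ :=
  ⨅ (δ : ℝ) (_ : 0 < δ), packingSup Ψ δ E

theorem packingPremeasure_empty {X : Type*} [MetricSpace X] (Ψ : ℝ → ℝ) :
    packingPremeasure Ψ (∅ : Set X) = 0 := by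
  refine le_antisymm (iInf₂_le_of_le 1 one_pos (iSup₂_le fun P hP => ?_)) bot_le
  have : P = ∅ := Set.eq_empty_of_forall_notMem fun p hp => hP.center_mem p hp
  subst this
  simp

theorem IsPacking.mono {X : Type*} [MetricSpace X] {δ δ' : ℝ} {E E' : Set X}
    {P : Set (X × ℝ)} (h : IsPacking δ E P) (hδ : δ ≤ δ') (hE : E ⊆ E') :
    IsPacking δ' E' P :=
  ⟨fun p hp => hE (h.center_mem p hp), h.radius_pos, fun p hp => (h.radius_le p hp).trans hδ,
    h.disjoint⟩

theorem packingSup_mono {X : Type*} [MetricSpace X] (Ψ : ℝ → ℝ) {δ δ' : ℝ} {E E' : Set X}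
    (hδ : δ ≤ δ') (hE : E ⊆ E') : packingSup Ψ δ E ≤ packingSup Ψ δ' E' :=
  iSup₂_le fun P hP => le_iSup₂_of_le P (hP.mono hδ hE) le_rfl

theorem packingPremeasure_mono {X : Type*} [MetricSpace X] (Ψ : ℝ → ℝ) {E E' : Set X}
    (hE : E ⊆ E') : packingPremeasure Ψ E ≤ packingPremeasure Ψ E' :=
  iInf₂_mono fun _ _ => packingSup_mono Ψ le_rfl hE

theorem packingPremeasure_add_le {X : Type*} [MetricSpace X] (Ψ : ℝ → ℝ) {s t : Set X}
    (h : Metric.AreSeparated s t) :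
    packingPremeasure Ψ s + packingPremeasure Ψ t ≤ packingPremeasure Ψ (s ∪ t) := by
  obtain ⟨r, hr0, hr⟩ := h
  obtain ⟨η, hη0, hη⟩ : ∃ η : ℝ, 0 < η ∧ ENNReal.ofReal (2 * η) < r := by
    obtain ⟨a, ha0, har⟩ := ENNReal.lt_iff_exists_nnreal_btwn.1 (pos_iff_ne_zero.2 hr0)
    refine ⟨a / 2, by simpa using ha0, ?_⟩
    rwa [mul_div_cancel₀ _ (two_ne_zero), ENNReal.ofReal_coe_nnreal]
  refine le_iInf₂ fun δ hδ => ?_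
  have hm : 0 < min δ η := lt_min hδ hη0
  refine le_trans (add_le_add (iInf₂_le _ hm) (iInf₂_le _ hm))
    (le_trans ?_ (packingSup_mono Ψ (min_le_left δ η) le_rfl))
  have hemp : ∀ E : Set X, IsPacking (min δ η) E ∅ := fun E =>
    ⟨by simp, by simp, by simp, by simp⟩
  refine ENNReal.biSup_add_biSup_le' (p := IsPacking (min δ η) s)
    (q := IsPacking (min δ η) t) ⟨∅, hemp s⟩ ⟨∅, hemp t⟩ fun P hP Q hQ => ?_
  have hlt : ∀ p ∈ P, ∀ q ∈ Q, p.2 + q.2 < dist p.1 q.1 := by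
    intro p hp q hq
    have h1 := hr _ (hP.center_mem p hp) _ (hQ.center_mem q hq)
    have h2 := hη.trans_le h1
    rw [edist_dist, ENNReal.ofReal_lt_ofReal_iff_of_nonneg (by linarith)] at h2
    have := (hP.radius_le p hp).trans (min_le_right _ _)
    have := (hQ.radius_le q hq).trans (min_le_right _ _)
    linarith
  have hball : ∀ p ∈ P, ∀ q ∈ Q,
      Disjoint (Metric.closedBall p.1 p.2) (Metric.closedBall q.1 q.2) := fun p hp q hq =>
    Metric.closedBall_disjoint_closedBall (hlt p hp q hq)
  have hdisj : Disjoint P Q := Set.disjoint_left.2 fun p hp hq => by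
    have := hlt p hp p hq
    have := hP.radius_pos p hp
    rw [dist_self] at *
    linarith
  have hPQ : IsPacking (min δ η) (s ∪ t) (P ∪ Q) := by
    refine ⟨?_, ?_, ?_, ?_⟩
    · rintro p (hp | hp)
      · exact Or.inl (hP.center_mem p hp)
      · exact Or.inr (hQ.center_mem p hp)
    · rintro p (hp | hp)
      · exact hP.radius_pos p hp
      · exact hQ.radius_pos p hp
    · rintro p (hp | hp)
      · exact hP.radius_le p hp
      · exact hQ.radius_le p hp
    · exact Set.pairwiseDisjoint_union.2
        ⟨hP.disjoint, hQ.disjoint, fun p hp q hq _ => hball p hp q hq⟩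
  refine le_trans (le_of_eq ?_) (le_iSup₂_of_le (P ∪ Q) hPQ le_rfl)
  exact (Summable.tsum_union_disjoint (f := fun p : X × ℝ => ENNReal.ofReal (Ψ (2 * p.2)))
    hdisj ENNReal.summable ENNReal.summable).symm

/-- The packing outer measure: the infimum of `∑ 𝒫^Ψ (E_i)` over countable coverings
`E ⊆ ⋃ E_i` by arbitrary sets. -/
def packingOuterMeasure {X : Type*} [MetricSpace X] (Ψ : ℝ → ℝ) : OuterMeasure X :=
  OuterMeasure.ofFunction (packingPremeasure Ψ) (packingPremeasure_empty Ψ)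

theorem packingOuterMeasure_isMetric {X : Type*} [MetricSpace X] (Ψ : ℝ → ℝ) :
    (packingOuterMeasure Ψ : OuterMeasure X).IsMetric := by
  intro s t hst
  refine le_antisymm (measure_union_le s t) ?_
  conv_rhs => rw [packingOuterMeasure, OuterMeasure.ofFunction_apply]
  refine le_iInf₂ fun f hf => ?_
  have hs : packingOuterMeasure Ψ s ≤ ∑' n, packingPremeasure Ψ (f n ∩ s) := by
    rw [packingOuterMeasure, OuterMeasure.ofFunction_apply]
    refine iInf₂_le _ ?_
    rw [← Set.iUnion_inter]
    exact Set.subset_inter (Set.subset_union_left.trans hf) le_rfl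
  have ht : packingOuterMeasure Ψ t ≤ ∑' n, packingPremeasure Ψ (f n ∩ t) := by
    rw [packingOuterMeasure, OuterMeasure.ofFunction_apply]
    refine iInf₂_le _ ?_
    rw [← Set.iUnion_inter]
    exact Set.subset_inter (Set.subset_union_right.trans hf) le_rfl
  refine (add_le_add hs ht).trans ?_
  rw [← ENNReal.tsum_add]
  refine ENNReal.tsum_le_tsum fun n => ?_
  refine (packingPremeasure_add_le Ψ
    (hst.mono Set.inter_subset_right Set.inter_subset_right)).trans ?_
  exact packingPremeasure_mono Ψ (Set.union_subset Set.inter_subset_left Set.inter_subset_left)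

/-- The packing measure with gauge `Ψ`, as a Borel measure. -/
def packingGaugeMeasure {X : Type*} [MetricSpace X] [MeasurableSpace X] [BorelSpace X]
    (Ψ : ℝ → ℝ) : Measure X :=
  (packingOuterMeasure Ψ).toMeasure
    (BorelSpace.measurable_eq (α := X) ▸ (packingOuterMeasure_isMetric Ψ).borel_le_caratheodory)

/-! ### `ℓ`-adic cubes and quasi-Bernoulli measures -/

/-- The `ℓ`-adic cube `∏ i, [k i / ℓ ^ n, (k i + 1) / ℓ ^ n)` of generation `n` in `[0,1)^D`. -/
def adicCube (D ℓ n : ℕ) (k : Fin D → Fin (ℓ ^ n)) : Set (EuclideanSpace ℝ (Fin D)) :=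
  {x | ∀ i, ((k i : ℕ) : ℝ) / (ℓ : ℝ) ^ n ≤ x i ∧ x i < (((k i : ℕ) : ℝ) + 1) / (ℓ : ℝ) ^ n}

/-- A coding of the `ℓ`-adic cubes by words over an alphabet with `ℓ ^ D` letters: for every
`n`, a bijection between the words of length `n` and the cubes of generation `n`, such that
deleting the last letter of a word gives a larger cube. -/
structure CubeCoding (D ℓ : ℕ) where
  code : ∀ n : ℕ, (Fin n → Fin (ℓ ^ D)) ≃ (Fin D → Fin (ℓ ^ n))
  nested : ∀ (n : ℕ) (w : Fin (n + 1) → Fin (ℓ ^ D)),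
    adicCube D ℓ (n + 1) (code (n + 1) w) ⊆ adicCube D ℓ n (code n (Fin.init w))

/-- The cube `I_w` coded by the word `w`. -/
def CubeCoding.cube {D ℓ : ℕ} (c : CubeCoding D ℓ) {n : ℕ} (w : Fin n → Fin (ℓ ^ D)) :
    Set (EuclideanSpace ℝ (Fin D)) :=
  adicCube D ℓ n (c.code n w)

/-- `m` is a quasi-Bernoulli probability measure on `[0,1)^D` with respect to the coding `c`.
If `I = I_w` and `J = I_v`, then `IJ` is the cube coded by the concatenation of `w` and `v`. -/
structure IsQuasiBernoulli {D ℓ : ℕ} (c : CubeCoding D ℓ)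
    (m : Measure (EuclideanSpace ℝ (Fin D))) : Prop where
  isProbabilityMeasure : IsProbabilityMeasure m
  unitCube : m {x | ∀ i, 0 ≤ x i ∧ x i < 1} = 1
  quasiMul : ∃ C : ℝ, 1 ≤ C ∧
    ∀ (n p : ℕ) (w : Fin n → Fin (ℓ ^ D)) (v : Fin p → Fin (ℓ ^ D)),
      1 / C * (m.real (c.cube w) * m.real (c.cube v)) ≤ m.real (c.cube (Fin.append w v)) ∧
      m.real (c.cube (Fin.append w v)) ≤ C * (m.real (c.cube w) * m.real (c.cube v))

open Classical in
/-- `τ_n(q) = (1 / (n log ℓ)) log (∑ m(I)^q)`, the sum running over the cubes `I` of generation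
`n` with `m(I) ≠ 0` (that is, with the convention `0 ^ q = 0` for all `q`). -/
def lqSpectrumAux (D ℓ : ℕ) (m : Measure (EuclideanSpace ℝ (Fin D))) (n : ℕ) (q : ℝ) : ℝ :=
  1 / ((n : ℝ) * Real.log ℓ) *
    Real.log (∑ k : Fin D → Fin (ℓ ^ n) with m.real (adicCube D ℓ n k) ≠ 0,
      m.real (adicCube D ℓ n k) ^ q)

/-- The `L^q`-spectrum `τ(q) = limsup τ_n(q)`. -/
def lqSpectrum (D ℓ : ℕ) (m : Measure (EuclideanSpace ℝ (Fin D))) (q : ℝ) : ℝ :=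
  limsup (fun n : ℕ => lqSpectrumAux D ℓ m n q) atTop

/-- `Θ(t) = ℓ ^ √(2 log_ℓ (1/t) log_ℓ log_ℓ log_ℓ (1/t))`; only small `t > 0` matter. -/
def lilTheta (ℓ : ℕ) (t : ℝ) : ℝ :=
  (ℓ : ℝ) ^ Real.sqrt (2 * Real.logb ℓ (1 / t) *
    Real.logb ℓ (Real.logb ℓ (Real.logb ℓ (1 / t))))

end

/-!
The quasi-Bernoulli property makes `m(I_w)^(1 - q) * ℓ^(-|w| τ(1 - q))` a weight on words which is
multiplicative up to a constant, whose sums over each generation lie between two positive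
constants. Hence, for an `m`-random word `w`, `m(I_w)^(-q) * ℓ^(-|w| τ(1 - q))` behaves like a
positive martingale and satisfies a maximal inequality. With `q = ± A / (N σ²)`, Chernoff's method
turns the expansion of `τ` at `1` into the Gaussian bound `ℓ^(-A² / (2 σ² N))` for the probability
that `|log_ℓ m(I_w) + |w| d|` exceeds `A` for some `|w| ≤ N`, uniformly for small `A / N`. By the
Borel–Cantelli lemma along geometric blocks of generations, for every `s > σ` the cube `I_n(x)` of
generation `n` around almost every point `x` satisfies
`|log_ℓ m(I_n(x)) + n d| ≤ s √(2 n log_ℓ log_ℓ n)` for large `n`.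

On the set where this holds from generation `n₀` on, a set of diameter at most `ℓ^(-n)` meets at
most `3^D` cubes of generation `n`, so its mass is bounded by the first gauge, and the mass
distribution principle gives absolute continuity. On the other hand a ball of radius `r` around `x`
contains the cube around `x` of a generation `log_ℓ (1/r) + O(1)`; as the exponent `σ + ε` exceeds
the constant `s`, the second gauge is negligible with respect to the mass of the ball, so that the
packing measure vanishes.
-/

/-! ### The rate of the law of the iterated logarithm -/

/-- The rate `√(2 x log_b log_b x)` of the law of the iterated logarithm, in base `b`. The square
root vanishes where `log_b log_b x < 0`; for `b > 1` the formula is meaningful from `x = b` on. -/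
noncomputable def lilRate (b x : ℝ) : ℝ :=
  √(2 * x * Real.logb b (Real.logb b x))

section LilRate

variable {b : ℝ}

theorem lilRate_nonneg (b x : ℝ) : 0 ≤ lilRate b x :=
  Real.sqrt_nonneg _

theorem one_le_logb_of_le {x : ℝ} (hb : 1 < b) (hx : b ≤ x) : 1 ≤ Real.logb b x := by
  rw [Real.le_logb_iff_rpow_le hb (by linarith), Real.rpow_one]
  exact hx

theorem logb_logb_nonneg {x : ℝ} (hb : 1 < b) (hx : b ≤ x) :
    0 ≤ Real.logb b (Real.logb b x) :=
  Real.logb_nonneg hb (one_le_logb_of_le hb hx)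

theorem sq_lilRate {x : ℝ} (hb : 1 < b) (hx : b ≤ x) :
    lilRate b x ^ 2 = 2 * x * Real.logb b (Real.logb b x) :=
  Real.sq_sqrt (mul_nonneg (by linarith) (logb_logb_nonneg hb hx))

theorem monotoneOn_lilRate (hb : 1 < b) : MonotoneOn (lilRate b) (Set.Ici b) := by
  intro x hx y _ hxy
  have hx : b ≤ x := hx
  have hlog : Real.logb b x ≤ Real.logb b y := Real.logb_le_logb_of_le hb (by linarith) hxy
  have hloglog : Real.logb b (Real.logb b x) ≤ Real.logb b (Real.logb b y) :=
    Real.logb_le_logb_of_le hb (by linarith [one_le_logb_of_le hb hx]) hlog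
  exact Real.sqrt_le_sqrt <|
    mul_le_mul (by linarith) hloglog (logb_logb_nonneg hb hx) (by linarith)

theorem tendsto_logb_logb_atTop (hb : 1 < b) :
    Tendsto (fun x => Real.logb b (Real.logb b x)) atTop atTop :=
  (Real.tendsto_logb_atTop hb).comp (Real.tendsto_logb_atTop hb)

theorem tendsto_lilRate_atTop (hb : 1 < b) : Tendsto (lilRate b) atTop atTop :=
  Real.tendsto_sqrt_atTop.comp <|
    (tendsto_id.const_mul_atTop two_pos).atTop_mul_atTop₀ (tendsto_logb_logb_atTop hb)

theorem eventually_logb_logb_mul_le {ρ : ℝ} (hb : 1 < b) (hρ : 1 < ρ) :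
    ∀ᶠ x in atTop, Real.logb b (Real.logb b (ρ * x)) ≤ ρ * Real.logb b (Real.logb b x) := by
  filter_upwards [eventually_ge_atTop b,
    (Real.tendsto_logb_atTop hb).eventually_ge_atTop (Real.logb b ρ / (b - 1)),
    (tendsto_logb_logb_atTop hb).eventually_ge_atTop (1 / (ρ - 1))] with x hx hlog hloglog
  rw [div_le_iff₀ (by linarith)] at hlog hloglog
  have hlog_pos : 0 < Real.logb b x := by linarith [one_le_logb_of_le hb hx]
  have hlog_mul : Real.logb b (ρ * x) = Real.logb b ρ + Real.logb b x :=
    Real.logb_mul (by linarith) (by linarith)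
  calc Real.logb b (Real.logb b (ρ * x)) ≤ Real.logb b (b * Real.logb b x) := by
        refine Real.logb_le_logb_of_le hb ?_ (by linarith)
        linarith [Real.logb_nonneg hb hρ.le]
    _ = 1 + Real.logb b (Real.logb b x) := by
        rw [Real.logb_mul (by linarith) hlog_pos.ne', Real.logb_self_eq_one hb]
    _ ≤ ρ * Real.logb b (Real.logb b x) := by linarith

theorem eventually_lilRate_mul_le {ρ : ℝ} (hb : 1 < b) (hρ : 1 < ρ) :
    ∀ᶠ x in atTop, lilRate b (ρ * x) ≤ ρ * lilRate b x := by
  filter_upwards [eventually_ge_atTop b, eventually_logb_logb_mul_le hb hρ] with x hx hloglog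
  refine Real.sqrt_le_iff.2 ⟨mul_nonneg (by linarith) (lilRate_nonneg b x), ?_⟩
  calc 2 * (ρ * x) * Real.logb b (Real.logb b (ρ * x))
      ≤ 2 * (ρ * x) * (ρ * Real.logb b (Real.logb b x)) :=
        mul_le_mul_of_nonneg_left hloglog (by nlinarith)
    _ = (ρ * lilRate b x) ^ 2 := by rw [mul_pow, sq_lilRate hb hx]; ring

theorem isLittleO_lilRate_id (hb : 1 < b) : lilRate b =o[atTop] (id : ℝ → ℝ) := by
  have hlogb : Real.logb b =o[atTop] (id : ℝ → ℝ) :=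
    (Real.isLittleO_log_id_atTop.const_mul_left (Real.log b)⁻¹).congr_left
      fun x => (div_eq_inv_mul (Real.log x) (Real.log b)).symm
  have hloglog : (fun x => Real.logb b (Real.logb b x)) =o[atTop] (id : ℝ → ℝ) :=
    (hlogb.comp_tendsto (Real.tendsto_logb_atTop hb)).trans hlogb
  refine IsLittleO.of_pow (n := 2) ?_ two_ne_zero
  have hprod : (fun x => 2 * x * Real.logb b (Real.logb b x)) =o[atTop] fun x => x * x :=
    ((isBigO_refl (id : ℝ → ℝ) atTop).const_mul_left 2).mul_isLittleO hloglog
  refine hprod.congr' ?_ (.of_forall fun x => (sq x).symm)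
  filter_upwards [eventually_ge_atTop b] with x hx using (sq_lilRate hb hx).symm

theorem rpow_neg_sq_lilRate {x s σ : ℝ} (hb : 1 < b) (hx : b ≤ x) :
    b ^ (-((s * lilRate b x) ^ 2 / (2 * σ ^ 2 * x))) = Real.logb b x ^ (-(s / σ) ^ 2) := by
  have hx0 : x ≠ 0 := by linarith
  have hexp : -((s * lilRate b x) ^ 2 / (2 * σ ^ 2 * x)) =
      Real.logb b (Real.logb b x) * -(s / σ) ^ 2 := by
    rw [mul_pow, sq_lilRate hb hx]
    field_simp
  rw [hexp, Real.rpow_mul (by linarith),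
    Real.rpow_logb (by linarith) hb.ne' (by linarith [one_le_logb_of_le hb hx])]

theorem summable_rpow_neg_sq_lilRate {ρ s σ : ℝ} (hb : 1 < b) (hρ : 1 < ρ) (hσ : 0 < σ)
    (hs : σ < s) :
    Summable fun k : ℕ => b ^ (-((s * lilRate b (ρ ^ k)) ^ 2 / (2 * σ ^ 2 * ρ ^ k))) := by
  have hexp : 1 < (s / σ) ^ 2 := one_lt_pow₀ ((one_lt_div hσ).2 hs) two_ne_zero
  have hsum := (Real.summable_nat_rpow.2 (neg_lt_neg hexp)).mul_left
    (Real.logb b ρ ^ (-(s / σ) ^ 2))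
  refine hsum.congr_atTop ?_
  filter_upwards [(tendsto_pow_atTop_atTop_of_one_lt hρ).eventually_ge_atTop b] with k hk
  rw [rpow_neg_sq_lilRate hb hk, Real.logb_pow, mul_comm,
    Real.mul_rpow (Nat.cast_nonneg k) (Real.logb_nonneg hb hρ.le)]

theorem eventually_mul_lilRate_add_le {s a : ℝ} (κ : ℝ) (hb : 1 < b) (hs : 0 < s) (ha : s < a) :
    ∀ᶠ y in atTop, ∀ z ∈ Set.Icc y (y + κ), s * lilRate b z ≤ a * lilRate b y := by
  have hρ : 1 < a / s := (one_lt_div hs).2 ha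
  filter_upwards [eventually_ge_atTop b, eventually_lilRate_mul_le hb hρ,
    eventually_ge_atTop (κ / (a / s - 1))] with y hy hrate hκ z hz
  rw [div_le_iff₀ (by linarith)] at hκ
  have hzy : z ≤ a / s * y := by linarith [hz.2]
  calc s * lilRate b z ≤ s * (a / s * lilRate b y) := by
        gcongr
        exact (monotoneOn_lilRate hb (hy.trans hz.1) ((hy.trans hz.1).trans hzy) hzy).trans hrate
    _ = a * lilRate b y := by field_simp

end LilRate

/-! ### Almost additive sequences -/

theorem exists_tendsto_div_and_mul_le_add {f : ℕ → ℝ} {k : ℝ}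
    (hf : ∀ n p, |f (n + p) - f n - f p| ≤ k) :
    ∃ L, Tendsto (fun n : ℕ => f n / n) atTop (𝓝 L) ∧ ∀ n : ℕ, n * L ≤ f n + k := by
  have hsub : Subadditive fun n => f n + k := fun n p => by
    linarith [(abs_le.1 (hf n p)).2]
  have hlower : ∀ n : ℕ, n * (f 1 - k) ≤ f n + k := by
    intro n
    induction n with
    | zero =>
      have h00 := (abs_le.1 (hf 0 0)).2
      norm_num at h00 ⊢
      linarith
    | succ n ih =>
      push_cast
      linarith [(abs_le.1 (hf n 1)).1]
  have hbdd : BddBelow (Set.range fun n : ℕ => (f n + k) / n) := by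
    refine ⟨min 0 (f 1 - k), ?_⟩
    rintro _ ⟨n, rfl⟩
    rcases n.eq_zero_or_pos with rfl | hn
    · simp
    · refine (min_le_right _ _).trans ((le_div_iff₀' ?_).2 (hlower n))
      exact_mod_cast hn
  refine ⟨hsub.lim, ?_, fun n => ?_⟩
  · refine ((hsub.tendsto_lim hbdd).sub (tendsto_const_div_atTop_nhds_zero_nat k)).congr'
      (.of_forall fun n => ?_) |>.trans (by rw [sub_zero])
    ring
  · rcases n.eq_zero_or_pos with rfl | hn
    · simpa using hlower 0
    · exact (le_div_iff₀' (by exact_mod_cast hn)).1 (hsub.lim_le_div hbdd hn.ne')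

theorem exists_tendsto_div_and_abs_sub_le {f : ℕ → ℝ} {k : ℝ}
    (hf : ∀ n p, |f (n + p) - f n - f p| ≤ k) :
    ∃ L, Tendsto (fun n : ℕ => f n / n) atTop (𝓝 L) ∧ ∀ n : ℕ, |f n - n * L| ≤ k := by
  obtain ⟨L, hL, hlower⟩ := exists_tendsto_div_and_mul_le_add hf
  have hneg : ∀ n p, |-f (n + p) - -f n - -f p| ≤ k := fun n p => by
    rw [← abs_neg]
    convert hf n p using 2
    ring
  obtain ⟨L', hL', hupper⟩ :=
    exists_tendsto_div_and_mul_le_add (f := fun n => -f n) hneg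
  obtain rfl : L' = -L := tendsto_nhds_unique hL' (hL.neg.congr fun n => (neg_div _ _).symm)
  refine ⟨L, hL, fun n => abs_le.2 ⟨?_, ?_⟩⟩
  · linarith [hlower n]
  · linarith [hupper n]

/-! ### Quasi-multiplicative weights on words -/

section WordSum

variable {A : Type*}

/-- A nonnegative weight on words which is multiplicative under concatenation up to the factor
`C`, and which does not vanish identically on any generation. -/
structure IsQuasiMultiplicative (C : ℝ) (φ : List A → ℝ) : Prop where
  one_le : 1 ≤ C
  nonneg : ∀ w, 0 ≤ φ w
  le_append : ∀ w v, C⁻¹ * (φ w * φ v) ≤ φ (w ++ v)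
  append_le : ∀ w v, φ (w ++ v) ≤ C * (φ w * φ v)
  exists_pos : ∀ n, ∃ w : List A, w.length = n ∧ 0 < φ w

namespace IsQuasiMultiplicative

variable {C : ℝ} {φ : List A → ℝ}

theorem const_pos (h : IsQuasiMultiplicative C φ) : 0 < C :=
  zero_lt_one.trans_le h.one_le

theorem rpow (h : IsQuasiMultiplicative C φ) {q : ℝ} (hq : 0 ≤ q) :
    IsQuasiMultiplicative (C ^ q) fun w => φ w ^ q where
  one_le := Real.one_le_rpow h.one_le hq
  nonneg w := Real.rpow_nonneg (h.nonneg w) q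
  le_append w v := by
    have hC := h.const_pos.le
    have hwv := mul_nonneg (h.nonneg w) (h.nonneg v)
    rw [← Real.inv_rpow hC, ← Real.mul_rpow (h.nonneg w) (h.nonneg v),
      ← Real.mul_rpow (inv_nonneg.2 hC) hwv]
    exact Real.rpow_le_rpow (mul_nonneg (inv_nonneg.2 hC) hwv) (h.le_append w v) hq
  append_le w v := by
    rw [← Real.mul_rpow (h.nonneg w) (h.nonneg v),
      ← Real.mul_rpow h.const_pos.le (mul_nonneg (h.nonneg w) (h.nonneg v))]
    exact Real.rpow_le_rpow (h.nonneg _) (h.append_le w v) hq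
  exists_pos n := by
    obtain ⟨w, hw, hpos⟩ := h.exists_pos n
    exact ⟨w, hw, Real.rpow_pos_of_pos hpos q⟩

theorem mul_pow_length (h : IsQuasiMultiplicative C φ) {r : ℝ} (hr : 0 < r) :
    IsQuasiMultiplicative C fun w => φ w * r ^ w.length where
  one_le := h.one_le
  nonneg w := mul_nonneg (h.nonneg w) (pow_nonneg hr.le _)
  le_append w v := by
    calc C⁻¹ * (φ w * r ^ w.length * (φ v * r ^ v.length))
        = C⁻¹ * (φ w * φ v) * (r ^ w.length * r ^ v.length) := by ring
      _ ≤ φ (w ++ v) * (r ^ w.length * r ^ v.length) := by gcongr; exact h.le_append w v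
      _ = _ := by rw [List.length_append, pow_add]
  append_le w v := by
    calc φ (w ++ v) * r ^ (w ++ v).length
        = φ (w ++ v) * (r ^ w.length * r ^ v.length) := by rw [List.length_append, pow_add]
      _ ≤ C * (φ w * φ v) * (r ^ w.length * r ^ v.length) := by gcongr; exact h.append_le w v
      _ = _ := by ring
  exists_pos n := by
    obtain ⟨w, hw, hpos⟩ := h.exists_pos n
    exact ⟨w, hw, mul_pos hpos (pow_pos hr _)⟩

end IsQuasiMultiplicative

variable [Fintype A]

/-- The sum of the weight `φ` over the words that extend `w` by `p` letters. -/
def wordSum (φ : List A → ℝ) (p : ℕ) (w : List A) : ℝ :=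
  ∑ v : Fin p → A, φ (w ++ List.ofFn v)

theorem wordSum_add (φ : List A → ℝ) (n p : ℕ) (w : List A) :
    wordSum φ (n + p) w = ∑ u : Fin n → A, wordSum φ p (w ++ List.ofFn u) := by
  rw [wordSum, ← (Fin.appendEquiv n p).sum_comp, Fintype.sum_prod_type]
  simp [wordSum, Fin.appendEquiv, List.ofFn_fin_append]

theorem wordSum_succ (φ : List A → ℝ) (p : ℕ) (w : List A) :
    wordSum φ (p + 1) w = ∑ a, wordSum φ p (w ++ [a]) := by
  rw [add_comm, wordSum_add, ← (Equiv.funUnique (Fin 1) A).symm.sum_comp]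
  simp

theorem wordSum_nonneg {φ : List A → ℝ} (hφ : ∀ w, 0 ≤ φ w) (p : ℕ) (w : List A) :
    0 ≤ wordSum φ p w :=
  Finset.sum_nonneg fun _ _ => hφ _

theorem wordSum_mul_pow_length (φ : List A → ℝ) (r : ℝ) (p : ℕ) (w : List A) :
    wordSum (fun v => φ v * r ^ v.length) p w = wordSum φ p w * r ^ (w.length + p) := by
  simp only [wordSum, Finset.sum_mul, List.length_append, List.length_ofFn]

/-- The exponential growth rate, in base `b`, of the sums of the weight `φ` over the words of
length `n`. -/
noncomputable def pressure (b : ℝ) (φ : List A → ℝ) : ℝ :=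
  limsup (fun n : ℕ => Real.logb b (wordSum φ n []) / n) atTop

namespace IsQuasiMultiplicative

variable {C : ℝ} {φ : List A → ℝ}

theorem wordSum_pos (h : IsQuasiMultiplicative C φ) (n : ℕ) : 0 < wordSum φ n [] := by
  obtain ⟨w, rfl, hw⟩ := h.exists_pos n
  exact Finset.sum_pos' (fun _ _ => h.nonneg _) ⟨w.get, Finset.mem_univ _, by simpa using hw⟩

theorem le_wordSum (h : IsQuasiMultiplicative C φ) (p : ℕ) (w : List A) :
    C⁻¹ * (φ w * wordSum φ p []) ≤ wordSum φ p w := by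
  simp only [wordSum, Finset.mul_sum, List.nil_append]
  exact Finset.sum_le_sum fun v _ => h.le_append w _

theorem wordSum_le (h : IsQuasiMultiplicative C φ) (p : ℕ) (w : List A) :
    wordSum φ p w ≤ C * (φ w * wordSum φ p []) := by
  simp only [wordSum, Finset.mul_sum, List.nil_append]
  exact Finset.sum_le_sum fun v _ => h.append_le w _

theorem le_wordSum_add (h : IsQuasiMultiplicative C φ) (n p : ℕ) :
    C⁻¹ * (wordSum φ n [] * wordSum φ p []) ≤ wordSum φ (n + p) [] := by
  rw [wordSum_add, wordSum, Finset.sum_mul, Finset.mul_sum]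
  exact Finset.sum_le_sum fun u _ => h.le_wordSum p _

theorem wordSum_add_le (h : IsQuasiMultiplicative C φ) (n p : ℕ) :
    wordSum φ (n + p) [] ≤ C * (wordSum φ n [] * wordSum φ p []) := by
  rw [wordSum_add, wordSum.eq_def φ n, Finset.sum_mul, Finset.mul_sum]
  exact Finset.sum_le_sum fun u _ => h.wordSum_le p _

theorem abs_logb_wordSum_add_sub_le {b : ℝ} (h : IsQuasiMultiplicative C φ) (hb : 1 < b)
    (n p : ℕ) :
    |Real.logb b (wordSum φ (n + p) []) - Real.logb b (wordSum φ n []) -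
      Real.logb b (wordSum φ p [])| ≤ Real.logb b C := by
  have hn := h.wordSum_pos n
  have hp := h.wordSum_pos p
  have hC := h.const_pos
  have hlower := Real.logb_le_logb_of_le hb (by positivity) (h.le_wordSum_add n p)
  have hupper := Real.logb_le_logb_of_le hb (h.wordSum_pos _) (h.wordSum_add_le n p)
  rw [Real.logb_mul (inv_pos.2 hC).ne' (mul_pos hn hp).ne', Real.logb_inv,
    Real.logb_mul hn.ne' hp.ne'] at hlower
  rw [Real.logb_mul hC.ne' (mul_pos hn hp).ne', Real.logb_mul hn.ne' hp.ne'] at hupper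
  rw [abs_le]
  constructor <;> linarith

theorem abs_logb_wordSum_sub_le {b : ℝ} (h : IsQuasiMultiplicative C φ) (hb : 1 < b) (n : ℕ) :
    |Real.logb b (wordSum φ n []) - n * pressure b φ| ≤ Real.logb b C := by
  obtain ⟨L, hL, hbound⟩ := exists_tendsto_div_and_abs_sub_le
    (f := fun n => Real.logb b (wordSum φ n [])) (h.abs_logb_wordSum_add_sub_le hb)
  rw [pressure, hL.limsup_eq]
  exact hbound n

theorem wordSum_normalized_mem_Icc {b : ℝ} (h : IsQuasiMultiplicative C φ) (hb : 1 < b)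
    (n : ℕ) :
    wordSum (fun w => φ w * (b ^ (-pressure b φ)) ^ w.length) n [] ∈ Set.Icc C⁻¹ C := by
  have hb0 : 0 < b := zero_lt_one.trans hb
  have hlog : Real.logb b (wordSum φ n [] * (b ^ (-pressure b φ)) ^ n) =
      Real.logb b (wordSum φ n []) - n * pressure b φ := by
    rw [Real.logb_mul (h.wordSum_pos n).ne' (by positivity), Real.logb_pow,
      Real.logb_rpow hb0 hb.ne']
    ring
  have hpos : 0 < wordSum φ n [] * (b ^ (-pressure b φ)) ^ n :=
    mul_pos (h.wordSum_pos n) (by positivity)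
  have habs := h.abs_logb_wordSum_sub_le hb n
  rw [← hlog, abs_le, ← Real.logb_inv, Real.logb_le_logb hb (inv_pos.2 h.const_pos) hpos,
    Real.logb_le_logb hb hpos h.const_pos] at habs
  rw [wordSum_mul_pow_length, List.length_nil, zero_add]
  exact habs

end IsQuasiMultiplicative

/-! ### The maximal inequality -/

section MaximalInequality

variable {X : Type*} [MeasurableSpace X] {I : List A → Set X} {μ : Measure X}
  [IsFiniteMeasure μ] {φ : List A → ℝ}

theorem measureReal_setOf_exists_append_le_wordSum (hI : ∀ w v, I (w ++ v) ⊆ I w)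
    (hφ : ∀ w, 0 ≤ φ w) {G : Set (List A)} (hG : ∀ w ∈ G, ∀ p, μ.real (I w) ≤ wordSum φ p w)
    (p : ℕ) (w : List A) :
    μ.real {x | ∃ v : List A, v.length ≤ p ∧ w ++ v ∈ G ∧ x ∈ I (w ++ v)} ≤ wordSum φ p w := by
  have of_mem : ∀ p, ∀ w ∈ G,
      μ.real {x | ∃ v : List A, v.length ≤ p ∧ w ++ v ∈ G ∧ x ∈ I (w ++ v)} ≤ wordSum φ p w := by
    refine fun p w hw => (measureReal_mono ?_).trans (hG w hw p)
    rintro x ⟨v, -, -, hx⟩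
    exact hI w v hx
  induction p generalizing w with
  | zero =>
    by_cases hw : w ∈ G
    · exact of_mem 0 w hw
    · have hempty : {x | ∃ v : List A, v.length ≤ 0 ∧ w ++ v ∈ G ∧ x ∈ I (w ++ v)} = ∅ := by
        ext x
        simp [hw]
      rw [hempty, measureReal_empty]
      exact wordSum_nonneg hφ 0 w
  | succ p ih =>
    by_cases hw : w ∈ G
    · exact of_mem (p + 1) w hw
    · have hsub : {x | ∃ v : List A, v.length ≤ p + 1 ∧ w ++ v ∈ G ∧ x ∈ I (w ++ v)} ⊆
          ⋃ a : A, {x | ∃ v : List A, v.length ≤ p ∧ w ++ [a] ++ v ∈ G ∧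
            x ∈ I (w ++ [a] ++ v)} := by
        rintro x ⟨v, hv, hvG, hx⟩
        cases v with
        | nil => exact absurd (by simpa using hvG) hw
        | cons a v =>
          exact Set.mem_iUnion.2 ⟨a, v, by simpa using hv, by simpa using hvG, by simpa using hx⟩
      rw [wordSum_succ]
      exact (measureReal_mono hsub).trans <|
        (measureReal_iUnion_fintype_le _).trans (Finset.sum_le_sum fun a _ => ih _)

/-- Quasi-multiplicativity makes the sums of `φ` over the descendants of a word nearly
constant in the depth, so `φ w / μ (I w)` behaves like a positive martingale. -/
theorem IsQuasiMultiplicative.measureReal_setOf_exists_mul_le_le {C : ℝ}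
    (h : IsQuasiMultiplicative C φ) (hI : ∀ w v, I (w ++ v) ⊆ I w)
    (hsum : ∀ n, wordSum φ n [] ∈ Set.Icc C⁻¹ C) {R : ℝ} (hR : 0 < R) (N : ℕ) :
    μ.real {x | ∃ w, w.length ≤ N ∧ R * μ.real (I w) ≤ φ w ∧ x ∈ I w} ≤ C ^ 3 / R := by
  have hC := h.const_pos
  have hbad : ∀ w ∈ {w | R * μ.real (I w) ≤ φ w}, ∀ p,
      μ.real (I w) ≤ wordSum (fun w => C ^ 2 / R * φ w) p w := by
    intro w hw p
    calc μ.real (I w) ≤ φ w / R := by rwa [le_div_iff₀' hR]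
      _ = C ^ 2 / R * (C⁻¹ * (φ w * C⁻¹)) := by field_simp
      _ ≤ C ^ 2 / R * (C⁻¹ * (φ w * wordSum φ p [])) := by
        have := h.nonneg w
        gcongr
        exact (hsum p).1
      _ ≤ C ^ 2 / R * wordSum φ p w := by gcongr; exact h.le_wordSum p w
      _ = _ := Finset.mul_sum _ _ _
  have hmax := measureReal_setOf_exists_append_le_wordSum hI
    (fun w => mul_nonneg (by positivity) (h.nonneg w)) hbad N []
  calc _ ≤ wordSum (fun w => C ^ 2 / R * φ w) N [] := hmax
    _ = C ^ 2 / R * wordSum φ N [] := (Finset.mul_sum _ _ _).symm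
    _ ≤ C ^ 2 / R * C := by gcongr; exact (hsum N).2
    _ = C ^ 3 / R := by ring

end MaximalInequality

end WordSum

/-! ### The law of the iterated logarithm on a tree of sets -/

section LawOfIteratedLogarithm

theorem ae_forall_mem_measureReal_pos {X ι : Type*} [Countable ι] [MeasurableSpace X]
    (μ : Measure X) [IsFiniteMeasure μ] (I : ι → Set X) :
    ∀ᵐ x ∂μ, ∀ i, x ∈ I i → 0 < μ.real (I i) := by
  refine ae_all_iff.2 fun i => ?_
  by_cases hi : μ (I i) = 0
  · filter_upwards [measure_eq_zero_iff_ae_notMem.1 hi] with x hx hxi using absurd hxi hx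
  · exact .of_forall fun _ _ => ENNReal.toReal_pos hi (measure_ne_top μ _)

theorem ae_forall_length_ge_of_summable_blocks {X A : Type*} [MeasurableSpace X]
    (μ : Measure X) [IsFiniteMeasure μ] {ρ : ℝ} (hρ : 1 < ρ) (I : List A → Set X)
    (P : List A → Prop) {u : ℕ → ℝ} (hu : Summable u)
    (hblock : ∀ᶠ k : ℕ in atTop, μ.real {x | ∃ w : List A, ρ ^ k ≤ w.length ∧
      (w.length : ℝ) ≤ ρ ^ (k + 1) ∧ ¬ P w ∧ x ∈ I w} ≤ u k) :
    ∀ᵐ x ∂μ, ∃ n₀ : ℕ, ∀ w : List A, n₀ ≤ w.length → x ∈ I w → P w := by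
  set B : ℕ → Set X := fun k => {x | ∃ w : List A, ρ ^ k ≤ w.length ∧
    (w.length : ℝ) ≤ ρ ^ (k + 1) ∧ ¬ P w ∧ x ∈ I w}
  have hsum : Summable fun k => μ.real (B k) :=
    hu.of_norm_bounded_eventually_nat <| hblock.mono fun k hk => by
      rwa [Real.norm_of_nonneg measureReal_nonneg]
  have hfin : ∑' k, μ (B k) ≠ ∞ := by simpa using hsum.tsum_ofReal_ne_top
  filter_upwards [ae_eventually_notMem hfin] with x hx
  obtain ⟨k₁, hk₁⟩ := eventually_atTop.1 hx
  refine ⟨⌈ρ ^ k₁⌉₊, fun w hw hxw => ?_⟩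
  have hlength : ρ ^ k₁ ≤ w.length := Nat.ceil_le.1 hw
  obtain ⟨k, hk, hk'⟩ := exists_nat_pow_near ((one_le_pow₀ hρ.le).trans hlength) hρ
  have hlt : k₁ < k + 1 := (pow_lt_pow_iff_right₀ hρ).1 (hlength.trans_lt hk')
  by_contra hP
  exact hk₁ k (by omega) ⟨w, hk, hk'.le, hP, hxw⟩

variable {X A : Type*} [MeasurableSpace X] [Fintype A] {I : List A → Set X} {μ : Measure X}
  [IsFiniteMeasure μ] {C b : ℝ}

namespace IsQuasiMultiplicative

theorem measureReal_setOf_exists_le_logb_le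
    (h : IsQuasiMultiplicative C fun w => μ.real (I w)) (hI : ∀ w v, I (w ++ v) ⊆ I w)
    (hb : 1 < b) {q : ℝ} (hq : q ∈ Set.Ico (-1) 1) (a : ℝ) (N : ℕ) :
    μ.real {x | ∃ w, w.length ≤ N ∧ x ∈ I w ∧ 0 < μ.real (I w) ∧
      a ≤ -q * Real.logb b (μ.real (I w)) -
        w.length * pressure b fun w => μ.real (I w) ^ (1 - q)} ≤ C ^ 6 * b ^ (-a) := by
  have hb0 : 0 < b := zero_lt_one.trans hb
  set p := pressure b fun w => μ.real (I w) ^ (1 - q)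
  have hpow := h.rpow (sub_nonneg.2 hq.2.le)
  have hnormalized := hpow.mul_pow_length (Real.rpow_pos_of_pos hb0 (-p))
  have hmax := hnormalized.measureReal_setOf_exists_mul_le_le (μ := μ) hI
    (hpow.wordSum_normalized_mem_Icc hb) (Real.rpow_pos_of_pos hb0 a) N
  have hconst : (C ^ (1 - q)) ^ 3 / b ^ a ≤ C ^ 6 * b ^ (-a) := by
    rw [Real.rpow_neg hb0.le, ← div_eq_mul_inv]
    gcongr
    calc (C ^ (1 - q)) ^ 3 ≤ (C ^ (2 : ℝ)) ^ 3 := by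
          have := h.const_pos
          gcongr
          · exact h.one_le
          · linarith [hq.1]
      _ = C ^ 6 := by rw [Real.rpow_two, ← pow_mul]
  refine (measureReal_mono ?_).trans (hmax.trans hconst)
  rintro x ⟨w, hw, hx, hpos, ha⟩
  refine ⟨w, hw, ?_, hx⟩
  have hexp : μ.real (I w) = b ^ Real.logb b (μ.real (I w)) :=
    (Real.rpow_logb hb0 hb.ne' hpos).symm
  generalize Real.logb b (μ.real (I w)) = y at ha hexp
  rw [hexp, ← Real.rpow_natCast, ← Real.rpow_mul hb0.le, ← Real.rpow_mul hb0.le,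
    ← Real.rpow_add hb0, ← Real.rpow_add hb0]
  exact Real.rpow_le_rpow_of_exponent_le hb.le (by linarith)

/-- Chernoff's bound; the value `q = t / (N s ^ 2)` optimizes the exponent. -/
theorem measureReal_setOf_exists_sq_le_le
    (h : IsQuasiMultiplicative C fun w => μ.real (I w)) (hI : ∀ w v, I (w ++ v) ⊆ I w)
    (hb : 1 < b) {d s q N : ℝ} (hs : 0 < s) (hN : 0 < N) (hq : q ∈ Set.Ico (-1) 1)
    (hpressure : pressure b (fun w => μ.real (I w) ^ (1 - q)) ≤ q * d + s ^ 2 / 2 * q ^ 2)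
    {t : ℝ} (ht : t = N * s ^ 2 * q) :
    μ.real {x | ∃ w, w.length ≤ N ∧ x ∈ I w ∧ 0 < μ.real (I w) ∧
      t ^ 2 ≤ -t * (Real.logb b (μ.real (I w)) + w.length * d)} ≤
      C ^ 6 * b ^ (-(t ^ 2 / (2 * s ^ 2 * N))) := by
  refine (measureReal_mono ?_).trans
    (h.measureReal_setOf_exists_le_logb_le hI hb hq (t ^ 2 / (2 * s ^ 2 * N)) ⌊N⌋₊)
  rintro x ⟨w, hw, hx, hpos, hdev⟩
  refine ⟨w, Nat.le_floor hw, hx, hpos, ?_⟩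
  set n : ℝ := (w.length : ℝ)
  set y := Real.logb b (μ.real (I w))
  have hdev' : N * s ^ 2 * q ^ 2 ≤ -q * (y + n * d) := by
    have hNs : 0 < N * s ^ 2 := by positivity
    refine le_of_mul_le_mul_left ?_ hNs
    rw [ht] at hdev
    linarith
  calc t ^ 2 / (2 * s ^ 2 * N) = N * s ^ 2 * q ^ 2 - N * (s ^ 2 / 2 * q ^ 2) := by
        rw [ht]
        field_simp
        ring
    _ ≤ -q * (y + n * d) - n * (s ^ 2 / 2 * q ^ 2) := by gcongr
    _ = -q * y - n * (q * d + s ^ 2 / 2 * q ^ 2) := by ring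
    _ ≤ _ := by gcongr

theorem exists_forall_measureReal_setOf_exists_le_abs_le
    (h : IsQuasiMultiplicative C fun w => μ.real (I w)) (hI : ∀ w v, I (w ++ v) ⊆ I w)
    (hb : 1 < b) {d s : ℝ} (hs : 0 < s)
    (hpressure : ∀ᶠ q in 𝓝 (0 : ℝ),
      pressure b (fun w => μ.real (I w) ^ (1 - q)) ≤ q * d + s ^ 2 / 2 * q ^ 2) :
    ∃ r > 0, ∀ N : ℝ, 0 < N → ∀ t ∈ Set.Icc 0 (r * N),
      μ.real {x | ∃ w, w.length ≤ N ∧ x ∈ I w ∧ 0 < μ.real (I w) ∧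
        t ≤ |Real.logb b (μ.real (I w)) + w.length * d|} ≤
        2 * C ^ 6 * b ^ (-(t ^ 2 / (2 * s ^ 2 * N))) := by
  obtain ⟨δ, hδ, hnear⟩ := Metric.eventually_nhds_iff.1
    (hpressure.and (Ico_mem_nhds (neg_one_lt_zero (R := ℝ)) one_pos))
  refine ⟨s ^ 2 * (δ / 2), by positivity, fun N hN t ht => ?_⟩
  set q := t / (N * s ^ 2) with hq
  have hNs : 0 < N * s ^ 2 := by positivity
  have hq0 : 0 ≤ q := div_nonneg ht.1 hNs.le
  have hqδ : q < δ := by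
    rw [hq, div_lt_iff₀ hNs]
    nlinarith [ht.2]
  have htq : t = N * s ^ 2 * q := by rw [hq]; field_simp
  obtain ⟨hpos, hqpos⟩ := hnear (y := q) (by simpa [abs_of_nonneg hq0] using hqδ)
  obtain ⟨hneg, hqneg⟩ := hnear (y := -q) (by simpa [abs_of_nonneg hq0] using hqδ)
  have hbelow := h.measureReal_setOf_exists_sq_le_le hI hb hs hN hqpos hpos htq
  have habove := h.measureReal_setOf_exists_sq_le_le hI hb hs hN hqneg hneg
    (t := -t) (by rw [htq]; ring)
  rw [neg_sq, neg_neg] at habove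
  refine (measureReal_mono ?_).trans ((measureReal_union_le _ _).trans
    ((add_le_add hbelow habove).trans_eq (by ring)))
  rintro x ⟨w, hw, hx, hmass, hdev⟩
  rcases le_abs.1 hdev with hdev | hdev
  · exact .inr ⟨w, hw, hx, hmass, by nlinarith [ht.1]⟩
  · exact .inl ⟨w, hw, hx, hmass, by nlinarith [ht.1]⟩

theorem eventually_measureReal_setOf_exists_block_le
    (h : IsQuasiMultiplicative C fun w => μ.real (I w)) (hI : ∀ w v, I (w ++ v) ⊆ I w)
    (hb : 1 < b) {d σ s ρ : ℝ} (hσ : 0 < σ) (hs : 0 < s) (hρ : 1 < ρ)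
    (hpressure : ∀ᶠ q in 𝓝 (0 : ℝ),
      pressure b (fun w => μ.real (I w) ^ (1 - q)) ≤ q * d + σ ^ 2 / 2 * q ^ 2) :
    ∀ᶠ k : ℕ in atTop, μ.real {x | ∃ w : List A, ρ ^ k ≤ w.length ∧
      (w.length : ℝ) ≤ ρ ^ (k + 1) ∧ ¬ (0 < μ.real (I w) →
        |Real.logb b (μ.real (I w)) + w.length * d| ≤ ρ * s * lilRate b w.length) ∧ x ∈ I w} ≤
      2 * C ^ 6 * b ^ (-((s * lilRate b (ρ ^ (k + 1))) ^ 2 / (2 * σ ^ 2 * ρ ^ (k + 1)))) := by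
  obtain ⟨r, hr, htail⟩ :=
    h.exists_forall_measureReal_setOf_exists_le_abs_le hI hb hσ hpressure
  have hpow : Tendsto (fun k : ℕ => ρ ^ k) atTop atTop := tendsto_pow_atTop_atTop_of_one_lt hρ
  filter_upwards [hpow.eventually_ge_atTop b, hpow.eventually (eventually_lilRate_mul_le hb hρ),
    (hpow.comp (tendsto_add_atTop_nat 1)).eventually
      ((isLittleO_lilRate_id hb).def (div_pos hr hs))] with k hk hrate hlittle
  have hN : 0 < ρ ^ (k + 1) := by positivity
  simp only [Function.comp_apply, Real.norm_of_nonneg (lilRate_nonneg _ _), id,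
    Real.norm_of_nonneg hN.le] at hlittle
  have hmoderate : s * lilRate b (ρ ^ (k + 1)) ≤ r * ρ ^ (k + 1) :=
    calc s * lilRate b (ρ ^ (k + 1)) ≤ s * (r / s * ρ ^ (k + 1)) := by gcongr
      _ = r * ρ ^ (k + 1) := by field_simp
  refine (measureReal_mono ?_).trans (htail (ρ ^ (k + 1)) hN (s * lilRate b (ρ ^ (k + 1)))
    ⟨mul_nonneg hs.le (lilRate_nonneg _ _), hmoderate⟩)
  rintro x ⟨w, hkw, hwk, hbad, hx⟩
  obtain ⟨hmass, hdev⟩ := Classical.not_imp.1 hbad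
  refine ⟨w, hwk, hx, hmass, le_trans ?_ (not_le.1 hdev).le⟩
  calc s * lilRate b (ρ ^ (k + 1)) ≤ s * (ρ * lilRate b (ρ ^ k)) := by
        rw [pow_succ']
        gcongr
    _ = ρ * s * lilRate b (ρ ^ k) := by ring
    _ ≤ ρ * s * lilRate b w.length := by
        gcongr
        exact monotoneOn_lilRate hb hk (hk.trans hkw) hkw

theorem ae_exists_forall_abs_logb_add_le
    (h : IsQuasiMultiplicative C fun w => μ.real (I w)) (hI : ∀ w v, I (w ++ v) ⊆ I w)
    (hb : 1 < b) {d σ s : ℝ} (hσ : 0 < σ) (hs : σ < s)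
    (hpressure : ∀ᶠ q in 𝓝 (0 : ℝ),
      pressure b (fun w => μ.real (I w) ^ (1 - q)) ≤ q * d + σ ^ 2 / 2 * q ^ 2) :
    ∀ᵐ x ∂μ, ∃ n₀ : ℕ, ∀ w, n₀ ≤ w.length → x ∈ I w → 0 < μ.real (I w) ∧
      |Real.logb b (μ.real (I w)) + w.length * d| ≤ s * lilRate b w.length := by
  obtain ⟨s', hσs', hs's⟩ := exists_between hs
  have hs' : 0 < s' := hσ.trans hσs'
  have hρ : 1 < s / s' := (one_lt_div hs').2 hs's
  have hsum := ((summable_nat_add_iff 1).2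
    (summable_rpow_neg_sq_lilRate hb hρ hσ hσs')).mul_left (2 * C ^ 6)
  have hblock := h.eventually_measureReal_setOf_exists_block_le hI hb hσ hs' hρ hpressure
  rw [div_mul_cancel₀ s hs'.ne'] at hblock
  filter_upwards [ae_forall_mem_measureReal_pos μ I,
    ae_forall_length_ge_of_summable_blocks μ hρ I _ hsum hblock] with x hpos ⟨n₀, hn₀⟩
  exact ⟨n₀, fun w hw hx => ⟨hpos w hx, hn₀ w hw hx (hpos w hx)⟩⟩

end IsQuasiMultiplicative

end LawOfIteratedLogarithm

/-! ### Adic cubes -/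

section AdicCube

variable {D ℓ : ℕ}

theorem mem_adicCube_iff (hℓ : 0 < ℓ) {n : ℕ} {k : Fin D → Fin (ℓ ^ n)}
    {x : EuclideanSpace ℝ (Fin D)} :
    x ∈ adicCube D ℓ n k ↔ ∀ i, ⌊x i * (ℓ : ℝ) ^ n⌋ = ((k i : ℕ) : ℤ) := by
  have hpow : (0 : ℝ) < (ℓ : ℝ) ^ n := by positivity
  simp only [adicCube, Set.mem_ofPred_eq, Int.floor_eq_iff, Int.cast_natCast, div_le_iff₀ hpow,
    lt_div_iff₀ hpow]

theorem eq_of_mem_adicCube (hℓ : 0 < ℓ) {n : ℕ} {k k' : Fin D → Fin (ℓ ^ n)}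
    {x : EuclideanSpace ℝ (Fin D)} (hk : x ∈ adicCube D ℓ n k) (hk' : x ∈ adicCube D ℓ n k') :
    k = k' := by
  funext i
  have heq := ((mem_adicCube_iff hℓ).1 hk i).symm.trans ((mem_adicCube_iff hℓ).1 hk' i)
  exact Fin.ext (Int.natCast_inj.1 heq)

theorem measurableSet_adicCube (D ℓ n : ℕ) (k : Fin D → Fin (ℓ ^ n)) :
    MeasurableSet (adicCube D ℓ n k) := by
  simp only [adicCube, Set.ofPred_forall, Set.ofPred_and]
  exact .iInter fun i => (measurableSet_le measurable_const (by fun_prop)).inter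
    (measurableSet_lt (by fun_prop) measurable_const)

theorem iUnion_adicCube (hℓ : 0 < ℓ) (n : ℕ) :
    ⋃ k, adicCube D ℓ n k = {x | ∀ i, 0 ≤ x i ∧ x i < 1} := by
  have hpow : (0 : ℝ) < (ℓ : ℝ) ^ n := by positivity
  refine Set.Subset.antisymm (Set.iUnion_subset fun k x hx i => ?_) fun x hx => ?_
  · have hk : (((k i : ℕ) : ℝ) + 1) / (ℓ : ℝ) ^ n ≤ 1 := by
      rw [div_le_one hpow]
      exact_mod_cast (k i).isLt
    exact ⟨le_trans (by positivity) (hx i).1, (hx i).2.trans_le hk⟩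
  · have hnonneg : ∀ i, 0 ≤ x i * (ℓ : ℝ) ^ n := fun i => mul_nonneg (hx i).1 hpow.le
    have hlt : ∀ i, ⌊x i * (ℓ : ℝ) ^ n⌋₊ < ℓ ^ n := fun i => by
      rw [Nat.floor_lt (hnonneg i), Nat.cast_pow]
      exact mul_lt_of_lt_one_left hpow (hx i).2
    exact Set.mem_iUnion.2 ⟨fun i => ⟨_, hlt i⟩, (mem_adicCube_iff hℓ).2 fun i =>
      (Int.natCast_floor_eq_floor (hnonneg i)).symm⟩

theorem dist_le_of_mem_adicCube {n : ℕ} {k : Fin D → Fin (ℓ ^ n)}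
    {x y : EuclideanSpace ℝ (Fin D)} (hx : x ∈ adicCube D ℓ n k) (hy : y ∈ adicCube D ℓ n k) :
    dist x y ≤ D * ((ℓ : ℝ) ^ n)⁻¹ := by
  have hcoord : ∀ i, dist (x i) (y i) ≤ ((ℓ : ℝ) ^ n)⁻¹ := fun i => by
    have hside : (((k i : ℕ) : ℝ) + 1) / (ℓ : ℝ) ^ n =
      ((k i : ℕ) : ℝ) / (ℓ : ℝ) ^ n + ((ℓ : ℝ) ^ n)⁻¹ := by ring
    rw [Real.dist_eq, abs_le]
    constructor <;> linarith [(hx i).1, (hx i).2, (hy i).1, (hy i).2]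
  rw [EuclideanSpace.dist_eq]
  refine Real.sqrt_le_iff.2 ⟨by positivity, ?_⟩
  calc ∑ i, dist (x i) (y i) ^ 2 ≤ ∑ _i : Fin D, (((ℓ : ℝ) ^ n)⁻¹) ^ 2 :=
        Finset.sum_le_sum fun i _ => pow_le_pow_left₀ dist_nonneg (hcoord i) 2
    _ = D * (((ℓ : ℝ) ^ n)⁻¹) ^ 2 := by
        rw [Finset.sum_const, Finset.card_univ, Fintype.card_fin, nsmul_eq_mul]
    _ ≤ (D * ((ℓ : ℝ) ^ n)⁻¹) ^ 2 := by
        rw [mul_pow]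
        gcongr
        exact_mod_cast Nat.le_self_pow two_ne_zero D

theorem natCast_mem_Icc_of_mem_adicCube_of_dist_le (hℓ : 0 < ℓ) {n : ℕ}
    {k k' : Fin D → Fin (ℓ ^ n)} {x y : EuclideanSpace ℝ (Fin D)} (hx : x ∈ adicCube D ℓ n k)
    (hy : y ∈ adicCube D ℓ n k') (hxy : dist x y ≤ ((ℓ : ℝ) ^ n)⁻¹) (i : Fin D) :
    ((k i : ℕ) : ℤ) ∈ Finset.Icc (((k' i : ℕ) : ℤ) - 1) (((k' i : ℕ) : ℤ) + 1) := by
  have hpow : (0 : ℝ) < (ℓ : ℝ) ^ n := by positivity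
  have hcoord : |x i - y i| ≤ ((ℓ : ℝ) ^ n)⁻¹ := by
    rw [← Real.dist_eq]
    exact (PiLp.dist_apply_le x y i).trans hxy
  have hscaled : |x i * (ℓ : ℝ) ^ n - y i * (ℓ : ℝ) ^ n| ≤ 1 := by
    rwa [← sub_mul, abs_mul, abs_of_pos hpow, ← le_div_iff₀ hpow, one_div]
  obtain ⟨hlower, hupper⟩ := abs_le.1 hscaled
  rw [← (mem_adicCube_iff hℓ).1 hx i, ← (mem_adicCube_iff hℓ).1 hy i, Finset.mem_Icc,
    ← Int.floor_sub_one, ← Int.floor_add_one]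
  exact ⟨Int.floor_mono (by linarith), Int.floor_mono (by linarith)⟩

open Classical in
theorem card_filter_nonempty_adicCube_inter_le (hℓ : 0 < ℓ) {n : ℕ}
    {E : Set (EuclideanSpace ℝ (Fin D))}
    (hE : Metric.ediam E ≤ ENNReal.ofReal ((ℓ : ℝ) ^ n)⁻¹) :
    (Finset.univ.filter fun k => (adicCube D ℓ n k ∩ E).Nonempty).card ≤ 3 ^ D := by
  rcases (Finset.univ.filter fun k => (adicCube D ℓ n k ∩ E).Nonempty).eq_empty_or_nonempty
    with hempty | ⟨k', hk'⟩
  · rw [hempty, Finset.card_empty]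
    positivity
  obtain ⟨y, hyk', hyE⟩ := (Finset.mem_filter.1 hk').2
  have hneighbours : (Fintype.piFinset fun i : Fin D =>
      Finset.Icc (((k' i : ℕ) : ℤ) - 1) (((k' i : ℕ) : ℤ) + 1)).card = 3 ^ D := by
    have hthree : ∀ a : ℤ, a + 1 + 1 - (a - 1) = 3 := fun a => by ring
    simp [hthree]
  rw [← hneighbours]
  refine Finset.card_le_card_of_injOn (fun k i => ((k i : ℕ) : ℤ)) (fun k hk => ?_)
    fun k₁ _ k₂ _ heq => funext fun i => Fin.ext (Int.natCast_inj.1 (congrFun heq i))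
  obtain ⟨x, hxk, hxE⟩ := (Finset.mem_filter.1 hk).2
  have hxy : dist x y ≤ ((ℓ : ℝ) ^ n)⁻¹ := by
    rw [← edist_le_ofReal (by positivity)]
    exact (Metric.edist_le_ediam_of_mem hxE hyE).trans hE
  exact Fintype.mem_piFinset.2 (natCast_mem_Icc_of_mem_adicCube_of_dist_le hℓ hxk hyk' hxy)

theorem measureReal_le_of_forall_adicCube_inter_nonempty (hℓ : 0 < ℓ)
    (m : Measure (EuclideanSpace ℝ (Fin D))) [IsFiniteMeasure m] {n : ℕ}
    {E : Set (EuclideanSpace ℝ (Fin D))} (hcover : E ⊆ ⋃ k, adicCube D ℓ n k)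
    (hE : Metric.ediam E ≤ ENNReal.ofReal ((ℓ : ℝ) ^ n)⁻¹) {B : ℝ} (hB : 0 ≤ B)
    (hle : ∀ k, (adicCube D ℓ n k ∩ E).Nonempty → m.real (adicCube D ℓ n k) ≤ B) :
    m.real E ≤ 3 ^ D * B := by
  classical
  set F := Finset.univ.filter fun k => (adicCube D ℓ n k ∩ E).Nonempty
  have hsub : E ⊆ ⋃ k ∈ F, adicCube D ℓ n k := fun x hx => by
    obtain ⟨k, hk⟩ := Set.mem_iUnion.1 (hcover hx)
    exact Set.mem_biUnion (Finset.mem_filter.2 ⟨Finset.mem_univ k, x, hk, hx⟩) hk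
  calc m.real E ≤ m.real (⋃ k ∈ F, adicCube D ℓ n k) :=
        measureReal_mono hsub (measure_ne_top m _)
    _ ≤ ∑ k ∈ F, m.real (adicCube D ℓ n k) := measureReal_biUnion_finset_le _ _
    _ ≤ F.card • B := Finset.sum_le_card_nsmul _ _ _ fun k hk => hle k (Finset.mem_filter.1 hk).2
    _ ≤ 3 ^ D * B := by
      rw [nsmul_eq_mul]
      gcongr
      exact_mod_cast card_filter_nonempty_adicCube_inter_le hℓ hE

end AdicCube

/-! ### Quasi-Bernoulli measures -/

section QuasiBernoulli

variable {D ℓ : ℕ} {c : CubeCoding D ℓ} {m : Measure (EuclideanSpace ℝ (Fin D))}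

namespace CubeCoding

/-- The cube coded by a word given as a list, so that concatenation of words is `++`. -/
def listCube (c : CubeCoding D ℓ) (w : List (Fin (ℓ ^ D))) : Set (EuclideanSpace ℝ (Fin D)) :=
  c.cube w.get

theorem listCube_ofFn (c : CubeCoding D ℓ) {n : ℕ} (w : Fin n → Fin (ℓ ^ D)) :
    c.listCube (List.ofFn w) = c.cube w := by
  have h : (⟨_, (List.ofFn w).get⟩ : Σ n, Fin n → Fin (ℓ ^ D)) = ⟨n, w⟩ :=
    List.ofFn_inj'.1 (List.ofFn_get _)
  exact congrArg (fun s : Σ n, Fin n → Fin (ℓ ^ D) => c.cube s.2) h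

theorem listCube_append_singleton_subset (c : CubeCoding D ℓ) (w : List (Fin (ℓ ^ D)))
    (a : Fin (ℓ ^ D)) : c.listCube (w ++ [a]) ⊆ c.listCube w := by
  have hnested := c.nested w.length (Fin.snoc (α := fun _ => Fin (ℓ ^ D)) w.get a)
  rw [Fin.init_snoc] at hnested
  have hsnoc : List.ofFn (Fin.snoc (α := fun _ => Fin (ℓ ^ D)) w.get a) = w ++ [a] := by
    simp only [List.ofFn_succ', Fin.snoc_castSucc, Fin.snoc_last, List.ofFn_get,
      List.concat_eq_append]
  rw [← hsnoc, listCube_ofFn]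
  exact hnested

theorem listCube_append_subset (c : CubeCoding D ℓ) (w v : List (Fin (ℓ ^ D))) :
    c.listCube (w ++ v) ⊆ c.listCube w := by
  induction v using List.reverseRecOn with
  | nil => rw [List.append_nil]
  | append_singleton v a ih =>
    rw [← List.append_assoc]
    exact (c.listCube_append_singleton_subset _ a).trans ih

theorem exists_listCube_eq (c : CubeCoding D ℓ) {n : ℕ} (k : Fin D → Fin (ℓ ^ n)) :
    ∃ w : List (Fin (ℓ ^ D)), w.length = n ∧ c.listCube w = adicCube D ℓ n k :=
  ⟨List.ofFn ((c.code n).symm k), List.length_ofFn, by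
    rw [listCube_ofFn, cube, Equiv.apply_symm_apply]⟩

theorem lqSpectrum_eq_pressure (c : CubeCoding D ℓ) (m : Measure (EuclideanSpace ℝ (Fin D)))
    {q : ℝ} (hq : q ≠ 0) :
    lqSpectrum D ℓ m q = pressure ℓ fun w => m.real (c.listCube w) ^ q := by
  classical
  refine congrArg (limsup · atTop) (funext fun n => ?_)
  have hwords : wordSum (fun w => m.real (c.listCube w) ^ q) n [] =
      ∑ k, m.real (adicCube D ℓ n k) ^ q := by
    simp only [wordSum, List.nil_append, listCube_ofFn]
    exact (c.code n).sum_comp fun k => m.real (adicCube D ℓ n k) ^ q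
  rw [hwords, lqSpectrumAux, Finset.sum_filter_of_ne, Real.logb]
  · ring
  · intro k _ hk hzero
    exact hk (by rw [hzero, Real.zero_rpow hq])

end CubeCoding

namespace IsQuasiBernoulli

theorem ae_mem_iUnion_adicCube (hm : IsQuasiBernoulli c m) (hℓ : 0 < ℓ) (n : ℕ) :
    ∀ᵐ x ∂m, x ∈ ⋃ k, adicCube D ℓ n k := by
  have := hm.isProbabilityMeasure
  refine (mem_ae_iff_prob_eq_one (.iUnion fun k => measurableSet_adicCube D ℓ n k)).2 ?_
  rw [iUnion_adicCube hℓ, hm.unitCube]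

theorem exists_isQuasiMultiplicative (hm : IsQuasiBernoulli c m) (hℓ : 0 < ℓ) :
    ∃ C, IsQuasiMultiplicative C fun w => m.real (c.listCube w) := by
  have := hm.isProbabilityMeasure
  obtain ⟨C, hC, hmul⟩ := hm.quasiMul
  have happend : ∀ w v : List (Fin (ℓ ^ D)),
      c.cube (Fin.append w.get v.get) = c.listCube (w ++ v) := fun w v => by
    rw [← c.listCube_ofFn, List.ofFn_fin_append, List.ofFn_get, List.ofFn_get]
  refine ⟨C, hC, fun w => measureReal_nonneg, fun w v => ?_, fun w v => ?_, fun n => ?_⟩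
  · rw [← happend, ← one_div]
    exact (hmul _ _ w.get v.get).1
  · rw [← happend]
    exact (hmul _ _ w.get v.get).2
  · obtain ⟨x, hpos, hx⟩ := ((ae_forall_mem_measureReal_pos m (adicCube D ℓ n)).and
      (hm.ae_mem_iUnion_adicCube hℓ n)).exists
    obtain ⟨k, hk⟩ := Set.mem_iUnion.1 hx
    obtain ⟨w, hw, hwk⟩ := c.exists_listCube_eq k
    exact ⟨w, hw, hwk ▸ hpos k hk⟩

end IsQuasiBernoulli

/-- The points for which, from generation `n₀` on, `log_ℓ m(I) + n d` stays within `s` times the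
rate of the law of the iterated logarithm, `I` being the adic cube of generation `n` around the
point. -/
def lilSet (ℓ : ℕ) (m : Measure (EuclideanSpace ℝ (Fin D))) (d s : ℝ) (n₀ : ℕ) :
    Set (EuclideanSpace ℝ (Fin D)) :=
  {x | ∀ n ≥ n₀, ∃ k, x ∈ adicCube D ℓ n k ∧ 0 < m.real (adicCube D ℓ n k) ∧
    |Real.logb ℓ (m.real (adicCube D ℓ n k)) + n * d| ≤ s * lilRate ℓ n}

theorem measurableSet_lilSet (ℓ : ℕ) (m : Measure (EuclideanSpace ℝ (Fin D))) (d s : ℝ)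
    (n₀ : ℕ) : MeasurableSet (lilSet ℓ m d s n₀) := by
  simp only [lilSet, Set.ofPred_forall, Set.ofPred_exists]
  exact .iInter fun n => .iInter fun _ => .iUnion fun k =>
    (measurableSet_adicCube D ℓ n k).inter (.const _)

theorem IsQuasiBernoulli.ae_mem_iUnion_lilSet (hm : IsQuasiBernoulli c m) (hℓ : 2 ≤ ℓ)
    {d σ s : ℝ} (hσ : 0 < σ) (hs : σ < s)
    (hτ : ∀ᶠ q in 𝓝 (0 : ℝ), lqSpectrum D ℓ m (1 - q) ≤ q * d + σ ^ 2 / 2 * q ^ 2) :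
    ∀ᵐ x ∂m, x ∈ ⋃ n₀, lilSet ℓ m d s n₀ := by
  have := hm.isProbabilityMeasure
  have hℓ0 : 0 < ℓ := by omega
  have hb : (1 : ℝ) < ℓ := by exact_mod_cast hℓ
  obtain ⟨C, hC⟩ := hm.exists_isQuasiMultiplicative hℓ0
  have hpressure : ∀ᶠ q in 𝓝 (0 : ℝ),
      pressure ℓ (fun w => m.real (c.listCube w) ^ (1 - q)) ≤ q * d + σ ^ 2 / 2 * q ^ 2 := by
    filter_upwards [hτ, gt_mem_nhds zero_lt_one] with q hq hq1
    rwa [← c.lqSpectrum_eq_pressure m (by linarith)]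
  filter_upwards [ae_all_iff.2 (hm.ae_mem_iUnion_adicCube hℓ0),
    hC.ae_exists_forall_abs_logb_add_le c.listCube_append_subset hb hσ hs hpressure]
    with x hcube ⟨n₀, hn₀⟩
  refine Set.mem_iUnion.2 ⟨n₀, fun n hn => ?_⟩
  obtain ⟨k, hk⟩ := Set.mem_iUnion.1 (hcube n)
  obtain ⟨w, rfl, hwk⟩ := c.exists_listCube_eq k
  exact ⟨k, hk, hwk ▸ hn₀ w hn (hwk ▸ hk)⟩

end QuasiBernoulli

/-! ### Comparison with gauge measures -/

section GaugeMeasure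

variable {X : Type*} [MeasurableSpace X] {μ : Measure X} {Ψ : ℝ → ℝ} {E : Set X}

theorem inv_smul_restrict_le_hausdorffGaugeMeasure [EMetricSpace X] [BorelSpace X]
    (hE : MeasurableSet E) {K : ℝ≥0∞}
    (h : ∀ᶠ t in 𝓝[>] (0 : ℝ), ∀ U : Set X, Metric.ediam U ≤ ENNReal.ofReal t →
      μ (U ∩ E) ≤ K * ENNReal.ofReal (Ψ t)) :
    K⁻¹ • μ.restrict E ≤ hausdorffGaugeMeasure Ψ := by
  obtain ⟨t₀, ht₀, hle⟩ := mem_nhdsGT_iff_exists_Ioc_subset.1 h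
  have ht₀ : 0 < t₀ := ht₀
  refine Measure.le_mkMetric _ _ (ENNReal.ofReal t₀) (by simpa using ht₀) fun U hU => ?_
  have hbound : ∀ t ∈ Set.Ioc 0 t₀, Metric.ediam U ≤ ENNReal.ofReal t →
      (K⁻¹ • μ.restrict E) U ≤ ENNReal.ofReal (Ψ t) := fun t ht hUt => by
    rw [Measure.smul_apply, smul_eq_mul, Measure.restrict_apply' hE, ← ENNReal.div_eq_inv_mul]
    exact ENNReal.div_le_of_le_mul' (hle ht U hUt)
  rw [gaugeValue]
  split_ifs with hzero
  · refine le_limsup_of_frequently_le' (Eventually.frequently ?_)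
    filter_upwards [Ioc_mem_nhdsGT ht₀] with t ht using hbound t ht (hzero ▸ zero_le)
  · have htop : Metric.ediam U ≠ ∞ := ne_top_of_le_ne_top ENNReal.ofReal_ne_top hU
    exact hbound _ ⟨ENNReal.toReal_pos hzero htop, ENNReal.toReal_le_of_le_ofReal ht₀.le hU⟩
      (ENNReal.ofReal_toReal htop).ge

theorem restrict_absolutelyContinuous_hausdorffGaugeMeasure [EMetricSpace X] [BorelSpace X]
    (hE : MeasurableSet E) {K : ℝ≥0∞} (hK : K ≠ ∞)
    (h : ∀ᶠ t in 𝓝[>] (0 : ℝ), ∀ U : Set X, Metric.ediam U ≤ ENNReal.ofReal t →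
      μ (U ∩ E) ≤ K * ENNReal.ofReal (Ψ t)) :
    μ.restrict E ≪ hausdorffGaugeMeasure Ψ :=
  (Measure.absolutelyContinuous_smul (ENNReal.inv_ne_zero.2 hK)).trans
    (inv_smul_restrict_le_hausdorffGaugeMeasure hE h).absolutelyContinuous

variable [MetricSpace X]

theorem packingPremeasure_le_mul_measure_univ [OpensMeasurableSpace X] {K : ℝ≥0∞}
    (h : ∀ᶠ t in 𝓝[>] (0 : ℝ), ∀ x ∈ E,
      ENNReal.ofReal (Ψ t) ≤ K * μ (Metric.closedBall x (t / 2))) :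
    packingPremeasure Ψ E ≤ K * μ Set.univ := by
  obtain ⟨t₀, ht₀, hle⟩ := mem_nhdsGT_iff_exists_Ioc_subset.1 h
  refine iInf₂_le_of_le (t₀ / 2) (half_pos ht₀) (iSup₂_le fun P hP => ?_)
  have hball : ∀ p : P,
      ENNReal.ofReal (Ψ (2 * p.1.2)) ≤ K * μ (Metric.closedBall p.1.1 p.1.2) := fun p => by
    have hmem : 2 * p.1.2 ∈ Set.Ioc 0 t₀ :=
      ⟨by linarith [hP.radius_pos p p.2], by linarith [hP.radius_le p p.2]⟩
    have hp := hle hmem p.1.1 (hP.center_mem p p.2)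
    rwa [mul_div_cancel_left₀ _ two_ne_zero] at hp
  calc ∑' p : P, ENNReal.ofReal (Ψ (2 * p.1.2))
      ≤ ∑' p : P, K * μ (Metric.closedBall p.1.1 p.1.2) := ENNReal.tsum_le_tsum hball
    _ = K * ∑' p : P, μ (Metric.closedBall p.1.1 p.1.2) := ENNReal.tsum_mul_left
    _ ≤ K * μ (⋃ p : P, Metric.closedBall p.1.1 p.1.2) := by
        gcongr
        exact tsum_meas_le_meas_iUnion_of_disjoint μ
          (fun p => Metric.isClosed_closedBall.measurableSet)
          fun p q hpq => hP.disjoint p.2 q.2 (Subtype.coe_injective.ne hpq)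
    _ ≤ K * μ Set.univ := by
        gcongr
        exact Set.subset_univ _

theorem packingPremeasure_eq_zero [OpensMeasurableSpace X] [IsFiniteMeasure μ]
    (h : ∀ η > 0, ∀ᶠ t in 𝓝[>] (0 : ℝ), ∀ x ∈ E,
      Ψ t ≤ η * μ.real (Metric.closedBall x (t / 2))) :
    packingPremeasure Ψ E = 0 := by
  have hlim : Tendsto (fun η : ℝ => ENNReal.ofReal η * μ Set.univ) (𝓝[>] 0) (𝓝 0) := by
    have hofReal : Tendsto ENNReal.ofReal (𝓝[>] 0) (𝓝 0) :=
      (ENNReal.continuous_ofReal.tendsto' 0 0 ENNReal.ofReal_zero).mono_left nhdsWithin_le_nhds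
    simpa using ENNReal.Tendsto.mul_const hofReal (Or.inr (measure_ne_top μ Set.univ))
  refine le_antisymm (ge_of_tendsto hlim ?_) zero_le
  filter_upwards [self_mem_nhdsWithin] with η hη
  refine packingPremeasure_le_mul_measure_univ ((h η hη).mono fun t ht x hx => ?_)
  rw [← ofReal_measureReal, ← ENNReal.ofReal_mul (le_of_lt hη)]
  exact ENNReal.ofReal_le_ofReal (ht x hx)

theorem packingGaugeMeasure_le_packingPremeasure [BorelSpace X] (hE : MeasurableSet E) :
    packingGaugeMeasure Ψ E ≤ packingPremeasure Ψ E := by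
  rw [packingGaugeMeasure, toMeasure_apply _ _ hE]
  exact OuterMeasure.ofFunction_le _

end GaugeMeasure

section LilGauge

variable {D ℓ : ℕ} {m : Measure (EuclideanSpace ℝ (Fin D))} {d s a : ℝ}

theorem eventually_nhdsGT_of_eventually_rpow_neg {b : ℝ} (hb : 1 < b) {p : ℝ → Prop}
    (h : ∀ᶠ x : ℝ in atTop, p (b ^ (-x))) : ∀ᶠ t in 𝓝[>] (0 : ℝ), p t := by
  filter_upwards [(tendsto_neg_atBot_atTop.comp (Real.tendsto_logb_nhdsGT_zero hb)).eventually h,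
    self_mem_nhdsWithin] with t ht ht0
  rwa [Function.comp_apply, neg_neg, Real.rpow_logb (by linarith) hb.ne' ht0] at ht

theorem rpow_mul_lilTheta_rpow (hℓ : 1 < ℓ) (d a x : ℝ) :
    ((ℓ : ℝ) ^ (-x)) ^ d * lilTheta ℓ ((ℓ : ℝ) ^ (-x)) ^ a =
      (ℓ : ℝ) ^ (-(x * d) + a * lilRate ℓ x) := by
  have hb : (1 : ℝ) < ℓ := by exact_mod_cast hℓ
  have hb0 : (0 : ℝ) < ℓ := by linarith
  have hlog : Real.logb ℓ (1 / (ℓ : ℝ) ^ (-x)) = x := by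
    rw [one_div, ← Real.rpow_neg hb0.le, neg_neg, Real.logb_rpow hb0 hb.ne']
  have htheta : lilTheta ℓ ((ℓ : ℝ) ^ (-x)) = (ℓ : ℝ) ^ lilRate ℓ x := by
    rw [lilTheta, hlog, lilRate]
  rw [htheta, ← Real.rpow_mul hb0.le, ← Real.rpow_mul hb0.le, ← Real.rpow_add hb0]
  congr 1
  ring

theorem measureReal_inter_lilSet_le [IsFiniteMeasure m] (hℓ : 1 < ℓ) {n₀ n : ℕ} (hn : n₀ ≤ n)
    {U : Set (EuclideanSpace ℝ (Fin D))}
    (hU : Metric.ediam U ≤ ENNReal.ofReal ((ℓ : ℝ) ^ n)⁻¹) :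
    m.real (U ∩ lilSet ℓ m d s n₀) ≤ 3 ^ D * (ℓ : ℝ) ^ (-(n * d) + s * lilRate ℓ n) := by
  refine measureReal_le_of_forall_adicCube_inter_nonempty (by omega) m (fun x hx => ?_)
    ((Metric.ediam_mono Set.inter_subset_left).trans hU) (by positivity) fun k ⟨x, hxk, hx⟩ => ?_
  · obtain ⟨k, hk, -⟩ := hx.2 n hn
    exact Set.mem_iUnion.2 ⟨k, hk⟩
  · obtain ⟨k', hk', hpos, hdev⟩ := hx.2 n hn
    obtain rfl := eq_of_mem_adicCube (by omega) hxk hk'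
    rw [← Real.logb_le_iff_le_rpow (by exact_mod_cast hℓ) hpos]
    linarith [(abs_le.1 hdev).2]

theorem eventually_neg_floor_mul_add_lilRate_le {b : ℝ} (hb : 1 < b) (d : ℝ) (hs : 0 ≤ s) :
    ∀ᶠ x : ℝ in atTop, -(⌊x⌋₊ * d) + s * lilRate b ⌊x⌋₊ ≤ |d| + (-(x * d) + s * lilRate b x) := by
  filter_upwards [tendsto_nat_floor_atTop.eventually
    (tendsto_natCast_atTop_atTop.eventually_ge_atTop b), eventually_ge_atTop 0] with x hbx hx
  have hfloor : (⌊x⌋₊ : ℝ) ≤ x := Nat.floor_le hx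
  have hrate : s * lilRate b ⌊x⌋₊ ≤ s * lilRate b x :=
    mul_le_mul_of_nonneg_left (monotoneOn_lilRate hb hbx (hbx.trans hfloor) hfloor) hs
  have hdrift : (x - ⌊x⌋₊) * d ≤ 1 * |d| :=
    calc (x - ⌊x⌋₊) * d ≤ (x - ⌊x⌋₊) * |d| :=
          mul_le_mul_of_nonneg_left (le_abs_self d) (sub_nonneg.2 hfloor)
      _ ≤ 1 * |d| := by
          gcongr
          linarith [Nat.lt_floor_add_one x]
  linarith

theorem eventually_measureReal_inter_lilSet_le_gauge [IsFiniteMeasure m] (hℓ : 1 < ℓ)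
    (hs : 0 ≤ s) (n₀ : ℕ) :
    ∀ᶠ t in 𝓝[>] (0 : ℝ), ∀ U : Set (EuclideanSpace ℝ (Fin D)),
      Metric.ediam U ≤ ENNReal.ofReal t →
      m.real (U ∩ lilSet ℓ m d s n₀) ≤ 3 ^ D * (ℓ : ℝ) ^ |d| * (t ^ d * lilTheta ℓ t ^ s) := by
  have hb : (1 : ℝ) < ℓ := by exact_mod_cast hℓ
  have hb0 : (0 : ℝ) < ℓ := by linarith
  refine eventually_nhdsGT_of_eventually_rpow_neg hb ?_
  filter_upwards [eventually_neg_floor_mul_add_lilRate_le hb d hs,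
    tendsto_nat_floor_atTop.eventually_ge_atTop n₀, eventually_ge_atTop 0] with x hexp hn hx U hU
  have hdiam : (ℓ : ℝ) ^ (-x) ≤ ((ℓ : ℝ) ^ ⌊x⌋₊)⁻¹ := by
    rw [← Real.rpow_natCast, ← Real.rpow_neg hb0.le]
    exact Real.rpow_le_rpow_of_exponent_le hb.le (neg_le_neg (Nat.floor_le hx))
  calc m.real (U ∩ lilSet ℓ m d s n₀)
      ≤ 3 ^ D * (ℓ : ℝ) ^ (-(⌊x⌋₊ * d) + s * lilRate ℓ ⌊x⌋₊) :=
        measureReal_inter_lilSet_le hℓ hn (hU.trans (ENNReal.ofReal_le_ofReal hdiam))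
    _ ≤ 3 ^ D * (ℓ : ℝ) ^ (|d| + (-(x * d) + s * lilRate ℓ x)) := by
        gcongr
        exact hb.le
    _ = 3 ^ D * (ℓ : ℝ) ^ |d| * (((ℓ : ℝ) ^ (-x)) ^ d * lilTheta ℓ ((ℓ : ℝ) ^ (-x)) ^ s) := by
        rw [rpow_mul_lilTheta_rpow hℓ, Real.rpow_add hb0, mul_assoc]

theorem restrict_lilSet_absolutelyContinuous [IsFiniteMeasure m] (hℓ : 1 < ℓ) (hs : 0 ≤ s)
    (n₀ : ℕ) :
    m.restrict (lilSet ℓ m d s n₀) ≪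
      hausdorffGaugeMeasure fun t : ℝ => t ^ d * lilTheta ℓ t ^ s := by
  refine restrict_absolutelyContinuous_hausdorffGaugeMeasure (measurableSet_lilSet ℓ m d s n₀)
    (K := ENNReal.ofReal (3 ^ D * (ℓ : ℝ) ^ |d|)) ENNReal.ofReal_ne_top ?_
  filter_upwards [eventually_measureReal_inter_lilSet_le_gauge (m := m) (d := d) hℓ hs n₀]
    with t ht U hU
  rw [← ofReal_measureReal, ← ENNReal.ofReal_mul (by positivity)]
  exact ENNReal.ofReal_le_ofReal (ht U hU)

theorem mul_inv_pow_le_rpow_neg_div_two (hℓ : 1 < ℓ) {n : ℕ} {y : ℝ} (hn : y + 2 * D ≤ n) :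
    D * ((ℓ : ℝ) ^ n)⁻¹ ≤ (ℓ : ℝ) ^ (-y) / 2 := by
  have hb : (1 : ℝ) < ℓ := by exact_mod_cast hℓ
  have hpow : (2 * D : ℝ) ≤ (ℓ : ℝ) ^ (2 * D : ℝ) := by
    exact_mod_cast (Nat.lt_pow_self (n := 2 * D) hℓ).le
  have hscale : (ℓ : ℝ) ^ (2 * D : ℝ) * ((ℓ : ℝ) ^ n)⁻¹ ≤ (ℓ : ℝ) ^ (-y) := by
    rw [← Real.rpow_natCast, ← Real.rpow_neg (by linarith), ← Real.rpow_add (by linarith)]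
    exact Real.rpow_le_rpow_of_exponent_le hb.le (by linarith)
  calc D * ((ℓ : ℝ) ^ n)⁻¹ = 2 * D * ((ℓ : ℝ) ^ n)⁻¹ / 2 := by ring
    _ ≤ (ℓ : ℝ) ^ (2 * D : ℝ) * ((ℓ : ℝ) ^ n)⁻¹ / 2 := by gcongr
    _ ≤ (ℓ : ℝ) ^ (-y) / 2 := by gcongr

theorem le_measureReal_closedBall_of_mem_lilSet [IsFiniteMeasure m] (hℓ : 1 < ℓ) {n₀ n : ℕ}
    (hn : n₀ ≤ n) {x : EuclideanSpace ℝ (Fin D)} (hx : x ∈ lilSet ℓ m d s n₀) {r : ℝ}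
    (hr : D * ((ℓ : ℝ) ^ n)⁻¹ ≤ r) :
    (ℓ : ℝ) ^ (-(n * d) - s * lilRate ℓ n) ≤ m.real (Metric.closedBall x r) := by
  obtain ⟨k, hk, hpos, hdev⟩ := hx n hn
  have hcube : (ℓ : ℝ) ^ (-(n * d) - s * lilRate ℓ n) ≤ m.real (adicCube D ℓ n k) := by
    rw [← Real.le_logb_iff_rpow_le (by exact_mod_cast hℓ) hpos]
    linarith [(abs_le.1 hdev).1]
  exact hcube.trans (measureReal_mono fun z hz =>
    Metric.mem_closedBall.2 ((dist_le_of_mem_adicCube hz hk).trans hr))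

theorem eventually_neg_mul_sub_lilRate_le {b : ℝ} (κ C d : ℝ) (hb : 1 < b) (hs : 0 < s)
    (ha : s < a) :
    ∀ᶠ y in atTop, ∀ z ∈ Set.Icc y (y + κ),
      -(y * d) - a * lilRate b y ≤ C + (-(z * d) - s * lilRate b z) := by
  obtain ⟨s', hs', hs'a⟩ := exists_between ha
  filter_upwards [eventually_mul_lilRate_add_le κ hb hs hs',
    (tendsto_lilRate_atTop hb).eventually_ge_atTop ((κ * |d| - C) / (a - s'))]
    with y hrate hlarge z hz
  rw [div_le_iff₀ (by linarith)] at hlarge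
  have hdrift : (z - y) * d ≤ κ * |d| :=
    calc (z - y) * d ≤ (z - y) * |d| :=
          mul_le_mul_of_nonneg_left (le_abs_self d) (sub_nonneg.2 hz.1)
      _ ≤ κ * |d| := by
          gcongr
          linarith [hz.2]
  linarith [hrate z hz]

theorem eventually_gauge_le_measureReal_closedBall [IsFiniteMeasure m] (hℓ : 1 < ℓ) (hs : 0 < s)
    (ha : s < a) (n₀ : ℕ) {η : ℝ} (hη : 0 < η) :
    ∀ᶠ t in 𝓝[>] (0 : ℝ), ∀ x ∈ lilSet ℓ m d s n₀,
      t ^ d * lilTheta ℓ t ^ (-a) ≤ η * m.real (Metric.closedBall x (t / 2)) := by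
  have hb : (1 : ℝ) < ℓ := by exact_mod_cast hℓ
  have hb0 : (0 : ℝ) < ℓ := by linarith
  refine eventually_nhdsGT_of_eventually_rpow_neg hb ?_
  filter_upwards [eventually_neg_mul_sub_lilRate_le (2 * D + 1) (Real.logb ℓ η) d hb hs ha,
    eventually_ge_atTop 0, eventually_ge_atTop (n₀ : ℝ)] with y hexp hy0 hyn₀ x hx
  obtain ⟨n, hn⟩ : ∃ n : ℕ, n = ⌈y⌉₊ + 2 * D := ⟨_, rfl⟩
  have hyn : y + 2 * D ≤ n := by
    rw [hn]
    push_cast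
    linarith [Nat.le_ceil y]
  have hny : n ≤ y + (2 * D + 1) := by
    rw [hn]
    push_cast
    linarith [Nat.ceil_lt_add_one hy0]
  have hn₀ : n₀ ≤ n := by exact_mod_cast (show (n₀ : ℝ) ≤ n by linarith)
  calc ((ℓ : ℝ) ^ (-y)) ^ d * lilTheta ℓ ((ℓ : ℝ) ^ (-y)) ^ (-a)
      = (ℓ : ℝ) ^ (-(y * d) - a * lilRate ℓ y) := by
        rw [rpow_mul_lilTheta_rpow hℓ, neg_mul, sub_eq_add_neg]
    _ ≤ (ℓ : ℝ) ^ (Real.logb ℓ η + (-(n * d) - s * lilRate ℓ n)) :=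
        Real.rpow_le_rpow_of_exponent_le hb.le (hexp n ⟨by linarith, hny⟩)
    _ = η * (ℓ : ℝ) ^ (-(n * d) - s * lilRate ℓ n) := by
        rw [Real.rpow_add hb0, Real.rpow_logb hb0 hb.ne' hη]
    _ ≤ η * m.real (Metric.closedBall x ((ℓ : ℝ) ^ (-y) / 2)) := by
        gcongr
        exact le_measureReal_closedBall_of_mem_lilSet hℓ hn₀ hx
          (mul_inv_pow_le_rpow_neg_div_two hℓ hyn)

theorem packingGaugeMeasure_iUnion_lilSet [IsFiniteMeasure m] (hℓ : 1 < ℓ) (hs : 0 < s)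
    (ha : s < a) :
    packingGaugeMeasure (fun t : ℝ => t ^ d * lilTheta ℓ t ^ (-a)) (⋃ n₀, lilSet ℓ m d s n₀) =
      0 := by
  refine measure_iUnion_null fun n₀ => le_antisymm ?_ zero_le
  calc _ ≤ packingPremeasure _ (lilSet ℓ m d s n₀) :=
        packingGaugeMeasure_le_packingPremeasure (measurableSet_lilSet ℓ m d s n₀)
    _ = 0 := packingPremeasure_eq_zero fun η hη =>
        eventually_gauge_le_measureReal_closedBall hℓ hs ha n₀ hη

end LilGauge

theorem eventually_le_add_mul_sq_of_isLittleO {f : ℝ → ℝ} {d σ s : ℝ} (hσ : 0 ≤ σ) (hs : σ < s)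
    (h : (fun q => f q - (q * d + σ ^ 2 / 2 * q ^ 2)) =o[𝓝 0] fun q : ℝ => q ^ 2) :
    ∀ᶠ q in 𝓝 (0 : ℝ), f q ≤ q * d + s ^ 2 / 2 * q ^ 2 := by
  have hgap : 0 < (s ^ 2 - σ ^ 2) / 2 := by nlinarith
  filter_upwards [h.def hgap] with q hq
  rw [Real.norm_eq_abs, Real.norm_of_nonneg (sq_nonneg q)] at hq
  linarith [le_of_abs_le hq]

theorem mainTheorem6_general {D ℓ : ℕ} (hℓ : 2 ≤ ℓ) {c : CubeCoding D ℓ}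
    {m : Measure (EuclideanSpace ℝ (Fin D))} (hm : IsQuasiBernoulli c m) {d σ : ℝ} (hσ : 0 ≤ σ)
    (hτ : ∀ s > σ, ∀ᶠ q in 𝓝 (0 : ℝ), lqSpectrum D ℓ m (1 - q) ≤ q * d + s ^ 2 / 2 * q ^ 2)
    {ε : ℝ} (hε : 0 < ε) :
    m ≪ hausdorffGaugeMeasure (fun t : ℝ => t ^ d * lilTheta ℓ t ^ (σ + ε)) ∧
    m ⟂ₘ packingGaugeMeasure (fun t : ℝ => t ^ d * lilTheta ℓ t ^ (-(σ + ε))) := by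
  have := hm.isProbabilityMeasure
  have hae : ∀ s > σ, ∀ᵐ x ∂m, x ∈ ⋃ n₀, lilSet ℓ m d s n₀ := fun s hs => by
    obtain ⟨s', hσs', hs's⟩ := exists_between hs
    exact hm.ae_mem_iUnion_lilSet hℓ (hσ.trans_lt hσs') hs's (hτ s' hσs')
  constructor
  · rw [← Measure.restrict_eq_self_of_ae_mem (hae (σ + ε) (by linarith))]
    exact Measure.restrict_iUnion_le.absolutelyContinuous.trans
      (Measure.absolutelyContinuous_sum_left fun n₀ =>
        restrict_lilSet_absolutelyContinuous hℓ (by linarith) n₀)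
  · refine ⟨(⋃ n₀, lilSet ℓ m d (σ + ε / 2) n₀)ᶜ,
      (MeasurableSet.iUnion fun n₀ => measurableSet_lilSet ℓ m d _ n₀).compl,
      hae (σ + ε / 2) (by linarith), ?_⟩
    rw [compl_compl]
    exact packingGaugeMeasure_iUnion_lilSet hℓ (by linarith) (by linarith)

theorem mainTheorem6 (D ℓ : ℕ) (hD : 1 ≤ D) (hℓ : 2 ≤ ℓ)
    (c : CubeCoding D ℓ) (m : Measure (EuclideanSpace ℝ (Fin D)))
    (hm : IsQuasiBernoulli c m)
    (d σ : ℝ) (hd : d = -deriv (lqSpectrum D ℓ m) 1) (hσ : 0 ≤ σ)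
    (hτ : (fun q : ℝ => lqSpectrum D ℓ m (1 - q) - (q * d + σ ^ 2 / 2 * q ^ 2))
      =o[𝓝 0] fun q : ℝ => q ^ 2)
    (ε : ℝ) (hε : 0 < ε) :
    m ≪ hausdorffGaugeMeasure (fun t : ℝ => t ^ d * lilTheta ℓ t ^ (σ + ε)) ∧
    m ⟂ₘ packingGaugeMeasure (fun t : ℝ => t ^ d * lilTheta ℓ t ^ (-(σ + ε))) :=
  mainTheorem6_general hℓ hm hσ (fun _ hs => eventually_le_add_mul_sq_of_isLittleO hσ hs hτ) hε
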